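/- Let $X$ be a finite connected graph (loops and multiple edges are allowed) in which every vertex has degree at least $3$ (a loop counts twice). Let $\mathcal M(X)$ be the set of metrics on $X$ obtained by assigning a positive length to every edge and making every edge isometric to an interval of that length, and let $\mathcal M_1(X)\subset\mathcal M(X)$ be the set of those metrics whose sum of edge lengths is $1$; two metrics are distinct if they differ in the length of some edge. Let $T$ be the universal covering tree of $X$, and for $d\in\mathcal M(X)$ let $\tilde d$ be the lifted path metric on $T$. Let $\mathcal H^1$ denote $1$-dimensional Hausdorff measure and $B_p(r)$ the $\tilde d$-ball of radius $r$ about a base point $p\in T$, a vertex. For every $d\in\mathcal M(X)$, $$\liminf_{r\to\infty}\frac{\ln \mathcal H^1(B_p(r))}{r}=\limsup_{r\to\infty}\frac{\ln \mathcal H^1(B_p(r))}{r};$$ the common value is the volume entropy $h_{vol}(d)$. There is exactly one $d_0\in\mathcal M_1(X)$ that minimizes $h_{vol}$ on $\mathcal M_1(X)$ (Lim's metric). For every $d_1\in\mathcal M_1(X)$ with $d_1\neq d_0$, the metric trees $(T,\tilde d_0)$ and $(T,\tilde d_1)$ are not almost-isometric: there are no $C\ge 0$ and no map $\phi:(T,\tilde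 d_0)\to(T,\tilde d_1)$ such that $$\tilde d_0(x,y)-C\le\tilde d_1(\phi x,\phi y)\le\tilde d_0(x,y)+C\quad\text{for all }x,y\in T,$$ and such that every point of $T$ is within $\tilde d_1$-distance $C$ of $\phi(T)$. -/

import Mathlib

open Filter MeasureTheory
open scoped MeasureTheory

/-- A graph in the sense of Serre, with vertex set `V` and set of *oriented* edges `E`. Loops and
multiple edges are allowed. Every oriented edge `e` has an origin `src e` and an opposite edge
`rev e ≠ e`; the unoriented edges are the pairs `{e, rev e}`. -/
structure SerreGraph (V E : Type*) where
  src : E → V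
  rev : E → E
  rev_rev : ∀ e, rev (rev e) = e
  rev_ne : ∀ e, rev e ≠ e

namespace SerreGraph

variable {V E : Type*}

/-- The terminal vertex of an oriented edge. -/
def tgt (G : SerreGraph V E) (e : E) : V := G.src (G.rev e)

/-- The degree of a vertex: the number of oriented edges issuing from it (a loop counts twice). -/
noncomputable def degree (G : SerreGraph V E) (v : V) : ℕ := {e : E | G.src e = v}.ncard

/-- Two vertices are adjacent if there is an edge from the first to the second. -/
def Adj (G : SerreGraph V E) (u v : V) : Prop := ∃ e, G.src e = u ∧ G.tgt e = v

/-- A graph is connected if it has a vertex and any two vertices are joined by an edge path. -/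
class Connected (G : SerreGraph V E) : Prop where
  nonempty : Nonempty V
  joined : ∀ u v : V, Relation.ReflTransGen G.Adj u v

/-- The metrics on a graph: assignments of positive lengths to the unoriented edges. -/
@[ext]
structure Lengths (G : SerreGraph V E) where
  len : E → ℝ
  pos : ∀ e, 0 < len e
  len_rev : ∀ e, len (G.rev e) = len e

/-- The sum of the lengths of the unoriented edges of a finite graph. -/
noncomputable def totalLength [Fintype E] (G : SerreGraph V E) (d : G.Lengths) : ℝ :=
  (∑ e, d.len e) / 2

/-! ### The metric graph: every edge is an interval of the prescribed length -/

/-- The disjoint union of the vertices and of one interval `[0, d.len e]` for every oriented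
edge `e`. -/
inductive Piece (G : SerreGraph V E) (d : G.Lengths) : Type _
  | vertex (v : V) : Piece G d
  | onEdge (e : E) (t : ℝ) (h₀ : 0 ≤ t) (h₁ : t ≤ d.len e) : Piece G d

/-- `PathCost x y c`: one can go from `x` to `y` by a path of length `c` made of segments inside
edges; the point at distance `t` from the origin on `e` is identified with the point at distance
`d.len e - t` from the origin on the opposite edge, and the initial point of `e` is identified
with the vertex `src e`. -/
inductive PathCost (G : SerreGraph V E) (d : G.Lengths) : Piece G d → Piece G d → ℝ → Prop
  | refl (x : Piece G d) : PathCost G d x x 0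
  | segment (e : E) (s t : ℝ) (hs₀ : 0 ≤ s) (hs₁ : s ≤ d.len e) (ht₀ : 0 ≤ t)
      (ht₁ : t ≤ d.len e) :
      PathCost G d (.onEdge e s hs₀ hs₁) (.onEdge e t ht₀ ht₁) |s - t|
  | flip (e : E) (s t : ℝ) (hs₀ : 0 ≤ s) (hs₁ : s ≤ d.len e) (ht₀ : 0 ≤ t)
      (ht₁ : t ≤ d.len (G.rev e)) (hst : s + t = d.len e) :
      PathCost G d (.onEdge e s hs₀ hs₁) (.onEdge (G.rev e) t ht₀ ht₁) 0
  | origin (e : E) (h₁ : (0 : ℝ) ≤ d.len e) :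
      PathCost G d (.onEdge e 0 le_rfl h₁) (.vertex (G.src e)) 0
  | symm {x y : Piece G d} {c : ℝ} : PathCost G d x y c → PathCost G d y x c
  | trans {x y z : Piece G d} {c c' : ℝ} :
      PathCost G d x y c → PathCost G d y z c' → PathCost G d x z (c + c')

theorem PathCost.nonneg {G : SerreGraph V E} {d : G.Lengths} {x y : Piece G d} {c : ℝ}
    (h : PathCost G d x y c) : 0 ≤ c := by
  induction h with
  | refl => exact le_rfl
  | segment => exact abs_nonneg _
  | flip => exact le_rfl
  | origin => exact le_rfl
  | symm _ ih => exact ih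
  | trans _ _ ih₁ ih₂ => exact add_nonneg ih₁ ih₂

theorem exists_pathCost_vertex (G : SerreGraph V E) (d : G.Lengths) (x : Piece G d) :
    ∃ v c, PathCost G d x (.vertex v) c := by
  cases x with
  | vertex v => exact ⟨v, 0, .refl _⟩
  | onEdge e t h₀ h₁ =>
    exact ⟨G.src e, _, (PathCost.segment e t 0 h₀ h₁ le_rfl (d.pos e).le).trans
      (.origin e (d.pos e).le)⟩

theorem exists_pathCost_edge (G : SerreGraph V E) (d : G.Lengths) (e : E) :
    ∃ c, PathCost G d (.vertex (G.src e)) (.vertex (G.tgt e)) c :=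
  ⟨_, (((PathCost.origin e (d.pos e).le).symm.trans
    (PathCost.segment e 0 (d.len e) le_rfl (d.pos e).le (d.pos e).le le_rfl)).trans
    (PathCost.flip e (d.len e) 0 (d.pos e).le le_rfl le_rfl (d.pos _).le (add_zero _))).trans
    (PathCost.origin (G.rev e) (d.pos _).le)⟩

theorem exists_pathCost (G : SerreGraph V E) [hG : G.Connected] (d : G.Lengths)
    (x y : Piece G d) : ∃ c, PathCost G d x y c := by
  obtain ⟨u, a, hu⟩ := exists_pathCost_vertex G d x
  obtain ⟨v, b, hv⟩ := exists_pathCost_vertex G d y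
  have key : ∀ v, Relation.ReflTransGen G.Adj u v →
      ∃ c, PathCost G d (.vertex u) (.vertex v) c := by
    intro v h
    induction h with
    | refl => exact ⟨0, .refl _⟩
    | tail _ h ih =>
      obtain ⟨e, rfl, rfl⟩ := h
      obtain ⟨c, hc⟩ := ih
      obtain ⟨c', hc'⟩ := exists_pathCost_edge G d e
      exact ⟨_, hc.trans hc'⟩
  obtain ⟨c, hc⟩ := key v (hG.joined u v)
  exact ⟨_, (hu.trans hc).trans hv.symm⟩

theorem bddBelow_pathCost (G : SerreGraph V E) (d : G.Lengths) (x y : Piece G d) :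
    BddBelow {c | PathCost G d x y c} := ⟨0, fun _ h => PathCost.nonneg h⟩

/-- The path (pseudo)distance: the infimum of the lengths of the paths between two points. -/
noncomputable instance (G : SerreGraph V E) [G.Connected] (d : G.Lengths) :
    PseudoMetricSpace (Piece G d) where
  dist x y := sInf {c | PathCost G d x y c}
  dist_self x := le_antisymm (csInf_le (bddBelow_pathCost G d x x) (.refl x))
    (Real.sInf_nonneg fun _ h => PathCost.nonneg h)
  dist_comm x y := congrArg sInf (Set.ext fun _ => ⟨.symm, .symm⟩)
  dist_triangle x y z := by
    refine le_of_forall_pos_lt_add fun ε hε => ?_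
    obtain ⟨a, ha, ha'⟩ := exists_lt_of_csInf_lt (exists_pathCost G d x y)
      (lt_add_of_pos_right (sInf {c | PathCost G d x y c}) (half_pos hε))
    obtain ⟨b, hb, hb'⟩ := exists_lt_of_csInf_lt (exists_pathCost G d y z)
      (lt_add_of_pos_right (sInf {c | PathCost G d y z c}) (half_pos hε))
    have := csInf_le (bddBelow_pathCost G d x z) (PathCost.trans ha hb)
    linarith

/-- The metric graph given by the edge lengths `d`: the space obtained from the vertices and the
edge intervals by identifying points at distance zero, with the path metric. -/
abbrev MetricGraph (G : SerreGraph V E) [G.Connected] (d : G.Lengths) : Type _ :=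
  SeparationQuotient (Piece G d)

/-- A vertex, as a point of the metric graph. -/
noncomputable def MetricGraph.vertex (G : SerreGraph V E) [G.Connected] (d : G.Lengths) (v : V) :
    MetricGraph G d := SeparationQuotient.mk (Piece.vertex v)

/-! ### The universal covering tree -/

/-- The end of an edge path starting at `v₀`. The *last* edge of the path is the head of the
list. -/
def endpoint (G : SerreGraph V E) (v₀ : V) : List E → V
  | [] => v₀
  | e :: _ => G.tgt e

/-- Edge paths starting at `v₀` (last edge first) without backtracking. -/
def IsReducedPath (G : SerreGraph V E) (v₀ : V) : List E → Prop
  | [] => True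
  | e :: w => G.src e = G.endpoint v₀ w ∧ w.head? ≠ some (G.rev e) ∧ G.IsReducedPath v₀ w

/-- Vertices of the universal cover: reduced edge paths starting at `v₀`. -/
def CoverVertex (G : SerreGraph V E) (v₀ : V) : Type _ := {w : List E // G.IsReducedPath v₀ w}

/-- Oriented edges of the universal cover: a vertex `w` of the universal cover (the origin)
together with an oriented edge of the graph that issues from the endpoint of `w`. -/
def CoverEdge (G : SerreGraph V E) (v₀ : V) : Type _ :=
  {p : G.CoverVertex v₀ × E // G.src p.2 = G.endpoint v₀ p.1.1}

open Classical in
/-- Append an edge to a reduced path, and cancel a backtracking. -/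
noncomputable def appendEdge (G : SerreGraph V E) (w : List E) (e : E) : List E :=
  if w.head? = some (G.rev e) then w.tail else e :: w

theorem isReducedPath_appendEdge (G : SerreGraph V E) (v₀ : V) (w : List E) (e : E)
    (hw : G.IsReducedPath v₀ w) (he : G.src e = G.endpoint v₀ w) :
    G.IsReducedPath v₀ (G.appendEdge w e) := by
  unfold appendEdge
  split_ifs with h
  · cases w with
    | nil => trivial
    | cons f w => exact hw.2.2
  · exact ⟨he, h, hw⟩

theorem endpoint_appendEdge (G : SerreGraph V E) (v₀ : V) (w : List E) (e : E)
    (hw : G.IsReducedPath v₀ w) : G.endpoint v₀ (G.appendEdge w e) = G.tgt e := by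
  unfold appendEdge
  split_ifs with h
  · cases w with
    | nil => simp at h
    | cons f w =>
      obtain rfl : f = G.rev e := by simpa using h
      exact hw.1.symm
  · rfl

theorem appendEdge_rev (G : SerreGraph V E) (v₀ : V) (w : List E) (e : E)
    (hw : G.IsReducedPath v₀ w) : G.appendEdge (G.appendEdge w e) (G.rev e) = w := by
  by_cases h : w.head? = some (G.rev e)
  · cases w with
    | nil => simp at h
    | cons f w =>
      obtain rfl : f = G.rev e := by simpa using h
      simp [appendEdge, hw.2.1]
  · simp [appendEdge, h, G.rev_rev]

theorem appendEdge_ne (G : SerreGraph V E) (w : List E) (e : E) : G.appendEdge w e ≠ w := by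
  unfold appendEdge
  split_ifs with h
  · cases w with
    | nil => simp at h
    | cons f w => simp
  · simp

/-- The universal covering tree of a graph, with respect to the base vertex `v₀`. The covering
projection sends a reduced path to its endpoint and the oriented edge `(w, e)` to `e`. -/
noncomputable def universalCover (G : SerreGraph V E) (v₀ : V) :
    SerreGraph (G.CoverVertex v₀) (G.CoverEdge v₀) where
  src p := p.1.1
  rev p := ⟨(⟨G.appendEdge p.1.1.1 p.1.2, G.isReducedPath_appendEdge v₀ _ _ p.1.1.2 p.2⟩,
    G.rev p.1.2), (G.endpoint_appendEdge v₀ _ _ p.1.1.2).symm⟩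
  rev_rev p := Subtype.ext (Prod.ext (Subtype.ext (G.appendEdge_rev v₀ _ _ p.1.1.2))
    (G.rev_rev _))
  rev_ne p h := G.rev_ne p.1.2 (congrArg (fun q => q.1.2) h)

/-- The base vertex of the universal cover: the trivial path. -/
def coverRoot (G : SerreGraph V E) (v₀ : V) : G.CoverVertex v₀ := ⟨[], trivial⟩

theorem universalCover_adj_symm (G : SerreGraph V E) (v₀ : V) (u v : G.CoverVertex v₀)
    (h : (G.universalCover v₀).Adj u v) : (G.universalCover v₀).Adj v u := by
  obtain ⟨e, rfl, rfl⟩ := h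
  exact ⟨(G.universalCover v₀).rev e, rfl, by
    unfold tgt
    rw [(G.universalCover v₀).rev_rev]⟩

theorem universalCover_joined (G : SerreGraph V E) (v₀ : V) : ∀ (w : List E)
    (hw : G.IsReducedPath v₀ w),
    Relation.ReflTransGen (G.universalCover v₀).Adj (G.coverRoot v₀) ⟨w, hw⟩
  | [], _ => .refl
  | e :: w, hw => by
    refine (universalCover_joined G v₀ w hw.2.2).tail
      ⟨⟨(⟨w, hw.2.2⟩, e), hw.1⟩, rfl, Subtype.ext ?_⟩
    exact if_neg hw.2.1

instance (G : SerreGraph V E) (v₀ : V) : (G.universalCover v₀).Connected where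
  nonempty := ⟨G.coverRoot v₀⟩
  joined u v := by
    have h := G.universalCover_joined v₀ u.1 u.2
    have h' : Relation.ReflTransGen (G.universalCover v₀).Adj u (G.coverRoot v₀) :=
      Relation.ReflTransGen.mono (fun a b => G.universalCover_adj_symm v₀ b a) _ _
        (Relation.reflTransGen_swap.mpr h)
    exact h'.trans (G.universalCover_joined v₀ v.1 v.2)

/-- The lift of a metric to the universal cover: an edge has the length of its projection. -/
def Lengths.lift {G : SerreGraph V E} (d : G.Lengths) (v₀ : V) :
    (G.universalCover v₀).Lengths where
  len p := d.len p.1.2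
  pos p := d.pos p.1.2
  len_rev p := d.len_rev p.1.2

/-- The metric tree `(T, d̃)`: the universal cover with the lifted metric. -/
abbrev MetricTree (G : SerreGraph V E) (d : G.Lengths) (v₀ : V) : Type _ :=
  MetricGraph (G.universalCover v₀) (d.lift v₀)

/-- The base point of the metric tree. -/
noncomputable def MetricTree.root (G : SerreGraph V E) (d : G.Lengths) (v₀ : V) : MetricTree G d v₀ :=
  MetricGraph.vertex (G.universalCover v₀) (d.lift v₀) (G.coverRoot v₀)

end SerreGraph

/-! ### Volume growth and almost-isometries of metric spaces -/

/-- The logarithm of the `s`-dimensional Hausdorff measure of the ball `B_p(r)`, divided by `r`. -/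
noncomputable def logVolumeRate {X : Type*} [MetricSpace X] (s : ℝ) (p : X) (r : ℝ) : EReal :=
  letI : MeasurableSpace X := borel X
  haveI : BorelSpace X := ⟨rfl⟩
  ENNReal.log (μH[s] (Metric.ball p r)) / (r : EReal)

/-- Upper exponential volume growth rate. -/
noncomputable def upperVolumeGrowth {X : Type*} [MetricSpace X] (s : ℝ) (p : X) : EReal :=
  limsup (logVolumeRate s p) atTop

/-- Lower exponential volume growth rate. -/
noncomputable def lowerVolumeGrowth {X : Type*} [MetricSpace X] (s : ℝ) (p : X) : EReal :=
  liminf (logVolumeRate s p) atTop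

/-- `(K, C)`-quasi-isometries. -/
def IsQuasiIsometry {X Y : Type*} [MetricSpace X] [MetricSpace Y] (K C : ℝ) (φ : X → Y) : Prop :=
  (∀ x₁ x₂, 1 / K * dist x₁ x₂ - C ≤ dist (φ x₁) (φ x₂) ∧
    dist (φ x₁) (φ x₂) ≤ K * dist x₁ x₂ + C) ∧
  ∀ y, ∃ x, dist (φ x) y ≤ C

/-- Two metric spaces are almost-isometric if there is a quasi-isometry with multiplicative
constant one from the first to the second. -/
def AlmostIsometric (X Y : Type*) [MetricSpace X] [MetricSpace Y] : Prop :=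
  ∃ C : ℝ, 0 ≤ C ∧ ∃ φ : X → Y, IsQuasiIsometry 1 C φ

namespace SerreGraph

variable {V E : Type*}

/-- The volume entropy of a metric on a graph: the exponential growth rate of the length
(one-dimensional Hausdorff measure) of balls in the universal covering tree. -/
noncomputable def volumeEntropy (G : SerreGraph V E) (v₀ : V) (d : G.Lengths) : EReal :=
  upperVolumeGrowth 1 (MetricTree.root G d v₀)

/-- `d` has total length one and its volume entropy is minimal among the metrics of total length
one. -/
def IsEntropyMinimizer [Fintype E] (G : SerreGraph V E) (v₀ : V) (d : G.Lengths) : Prop :=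
  G.totalLength d = 1 ∧
    ∀ d' : G.Lengths, G.totalLength d' = 1 → G.volumeEntropy v₀ d ≤ G.volumeEntropy v₀ d'

end SerreGraph

namespace SerreGraph

variable {V E : Type*}

/-! ### Edges following an edge without backtracking -/

/-! The volume entropy is a Perron–Frobenius parameter. For every metric `d` there are `h ≥ 0` and a
positive vector `x` on the oriented edges such that `x e` is the sum of `exp (-h * d.len f) * x f`
over the edges `f` that follow `e` without backtracking (`exists_pos_transfer_eq_self`). Such an `x`
puts a conserved flow on the tree. Cutting the tree at distance `r` from the root then shows that
the number of vertices within `r` is comparable to `exp (h * r)`. The length of balls is comparable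
to this number up to a bounded shift of the radius, so the growth rate is a genuine limit, equal to
`h`.

For the lower bound, let `q` be the degree minus one and compare the walk with transition
probabilities `exp (-h * d.len f) * x f / x e` with the uniform walk, whose probabilities are `1 /
q`. The uniform measure on oriented edges is stationary for the uniform walk, so in the averaged
logarithm of the ratio of probabilities the terms `log x` cancel, and `2 * (walkEntropy - h *
totalLength)` remains. By `log t ≤ t - 1` this is at most zero (`walkEntropy_le`). Equality forces
the two walks to coincide, and this determines every length (`mul_len_eq_of_walkEntropy_eq`).
Conversely, the resulting metric has an explicit fixed vector with `h = walkEntropy`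
(`transfer_limLengths`), so it is the unique minimizer.

An almost-isometry changes vertex counts by at most a bounded factor and a bounded shift of the
radius. If Lim's metric is almost-isometric to `d₁`, the entropy of `d₁` is therefore at most the
minimum, and uniqueness identifies the two metrics. -/

theorem rev_injective (G : SerreGraph V E) : Function.Injective G.rev :=
  Function.Involutive.injective G.rev_rev

theorem tgt_rev (G : SerreGraph V E) (e : E) : G.tgt (G.rev e) = G.src e := by
  unfold tgt
  rw [G.rev_rev]

open Classical in
/-- The edges that continue the edge `e` without backtracking. -/
noncomputable def next [Fintype E] (G : SerreGraph V E) (e : E) : Finset E :=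
  {f | G.src f = G.tgt e ∧ f ≠ G.rev e}

theorem mem_next [Fintype E] {G : SerreGraph V E} {e f : E} :
    f ∈ G.next e ↔ G.src f = G.tgt e ∧ f ≠ G.rev e := by
  simp [next]

/-- The number of continuations, without backtracking, of a path arriving at `v`. -/
noncomputable def branching (G : SerreGraph V E) (v : V) : ℝ := G.degree v - 1

theorem two_le_branching {G : SerreGraph V E} (hdeg : ∀ v, 3 ≤ G.degree v) (v : V) :
    2 ≤ G.branching v := by
  have : (3 : ℝ) ≤ G.degree v := by exact_mod_cast hdeg v
  unfold branching
  linarith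

open Classical in
theorem degree_eq_card [Fintype E] (G : SerreGraph V E) (v : V) :
    G.degree v = (Finset.univ.filter fun e => G.src e = v).card := by
  rw [degree, ← Set.ncard_coe_finset]
  simp

open Classical in
theorem card_filter_src_ne [Fintype E] (G : SerreGraph V E) (e : E) :
    ((Finset.univ.filter fun f => G.src f = G.src e ∧ f ≠ e).card : ℝ) =
      G.branching (G.src e) := by
  have h : (Finset.univ.filter fun f => G.src f = G.src e ∧ f ≠ e) =
      (Finset.univ.filter fun f => G.src f = G.src e).erase e := by
    ext f
    simp [and_comm]
  have he : e ∈ Finset.univ.filter fun f => G.src f = G.src e := by simp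
  rw [h, branching, degree_eq_card, ← Finset.card_erase_add_one he]
  push_cast
  ring

theorem card_next [Fintype E] (G : SerreGraph V E) (e : E) :
    ((G.next e).card : ℝ) = G.branching (G.tgt e) :=
  G.card_filter_src_ne (G.rev e)

open Classical in
-- Reversal turns the predecessors of `f` into the edges other than `f` issuing from its origin. At
-- each vertex an edge therefore has as many predecessors as arriving edges have successors, which
-- is what makes the uniform measure stationary.
theorem card_filter_mem_next [Fintype E] (G : SerreGraph V E) (f : E) :
    ((Finset.univ.filter fun e => f ∈ G.next e).card : ℝ) = G.branching (G.src f) := by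
  rw [← G.card_filter_src_ne f]
  congr 1
  refine Finset.card_bij (fun e _ => G.rev e) ?_ (fun _ _ _ _ h => G.rev_injective h) ?_
  · intro e he
    simp only [Finset.mem_filter, Finset.mem_univ, true_and, mem_next] at he ⊢
    exact ⟨he.1.symm, fun h => he.2 h.symm⟩
  · intro g hg
    simp only [Finset.mem_filter, Finset.mem_univ, true_and, mem_next] at hg ⊢
    exact ⟨G.rev g, ⟨by rw [tgt_rev, hg.1], by rw [G.rev_rev]; exact hg.2.symm⟩, G.rev_rev g⟩

/-- The uniform measure on oriented edges is stationary for the non-backtracking walk. -/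
theorem sum_branching_inv_mul_sum_next [Fintype E] (G : SerreGraph V E)
    (hdeg : ∀ v, 3 ≤ G.degree v) (g : E → ℝ) :
    ∑ e, (G.branching (G.tgt e))⁻¹ * ∑ f ∈ G.next e, g f = ∑ f, g f := by
  classical
  have h : ∀ e, (G.branching (G.tgt e))⁻¹ * ∑ f ∈ G.next e, g f =
      ∑ f, if f ∈ G.next e then (G.branching (G.src f))⁻¹ * g f else 0 := by
    intro e
    rw [← Finset.sum_filter, Finset.filter_mem_eq_inter, Finset.univ_inter, Finset.mul_sum]
    refine Finset.sum_congr rfl fun f hf => ?_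
    rw [(mem_next.1 hf).1]
  simp only [h]
  rw [Finset.sum_comm]
  refine Finset.sum_congr rfl fun f _ => ?_
  rw [← Finset.sum_filter, Finset.sum_const, nsmul_eq_mul, card_filter_mem_next, ← mul_assoc,
    mul_inv_cancel₀ (by linarith [two_le_branching hdeg (G.src f)]), one_mul]

theorem exists_src_eq_ne_ne [Fintype E] {G : SerreGraph V E} (hdeg : ∀ v, 3 ≤ G.degree v) (v : V)
    (a b : E) : ∃ e, G.src e = v ∧ e ≠ a ∧ e ≠ b := by
  classical
  have h : ({a, b} : Finset E).card < (Finset.univ.filter fun e => G.src e = v).card := by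
    rw [← degree_eq_card]
    exact lt_of_le_of_lt Finset.card_le_two (hdeg v)
  obtain ⟨e, he, he'⟩ := Finset.exists_mem_notMem_of_card_lt_card h
  simp only [Finset.mem_filter, Finset.mem_univ, true_and] at he
  simp only [Finset.mem_insert, Finset.mem_singleton, not_or] at he'
  exact ⟨e, he, he'.1, he'.2⟩

/-- For a forward-closed set, averaging the indicator over successors never decreases it. By
stationarity the total is unchanged, so it cannot increase anywhere, whereas an edge outside `S`
with a successor in `S` would make it increase. -/
theorem mem_of_mem_next_of_closed [Fintype E] {G : SerreGraph V E} (hdeg : ∀ v, 3 ≤ G.degree v)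
    {S : Set E} (hS : ∀ e ∈ S, ∀ f ∈ G.next e, f ∈ S) {e f : E} (hf : f ∈ S)
    (hef : f ∈ G.next e) : e ∈ S := by
  classical
  by_contra he
  have hq : ∀ v, 0 < G.branching v := fun v => by linarith [two_le_branching hdeg v]
  have key := G.sum_branching_inv_mul_sum_next hdeg (fun f => if f ∈ S then 1 else 0)
  refine absurd key (ne_of_gt (Finset.sum_lt_sum (fun a _ => ?_) ⟨e, Finset.mem_univ e, ?_⟩))
  · split_ifs with ha
    · rw [Finset.sum_congr rfl fun b hb => if_pos (hS a ha b hb), Finset.sum_const, nsmul_eq_mul,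
        mul_one, card_next, inv_mul_cancel₀ (hq _).ne']
    · exact mul_nonneg (inv_nonneg.2 (hq _).le)
        (Finset.sum_nonneg fun b _ => by split_ifs <;> norm_num)
  · rw [if_neg he]
    refine mul_pos (inv_pos.2 (hq _)) (Finset.sum_pos' (fun b _ => by split_ifs <;> norm_num)
      ⟨f, hef, by rw [if_pos hf]; exact one_pos⟩)

/-- The non-backtracking walk on a connected graph with degrees at least three is irreducible. -/
theorem eq_univ_of_closed [Fintype E] {G : SerreGraph V E} [hG : G.Connected]
    (hdeg : ∀ v, 3 ≤ G.degree v) {S : Set E} (hS : ∀ e ∈ S, ∀ f ∈ G.next e, f ∈ S)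
    (hne : S.Nonempty) : S = Set.univ := by
  -- The only edge not reached directly from `e` is `G.rev e`. With two further edges `g`, `g'` at
  -- the same vertex, go forward from `e` to `g`, backward from `g` to `G.rev g'`, and forward again
  -- to `G.rev e`.
  have step : ∀ e ∈ S, ∀ f, G.src f = G.tgt e → f ∈ S := by
    intro e he f hf
    by_cases hfe : f = G.rev e
    · obtain ⟨g, hg, hge, -⟩ := exists_src_eq_ne_ne hdeg (G.tgt e) (G.rev e) (G.rev e)
      obtain ⟨g', hg', hge', hgg'⟩ := exists_src_eq_ne_ne hdeg (G.tgt e) (G.rev e) g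
      have h₁ : g ∈ S := hS e he g (mem_next.2 ⟨hg, hge⟩)
      have h₂ : G.rev g' ∈ S := mem_of_mem_next_of_closed hdeg hS h₁
        (mem_next.2 ⟨by rw [tgt_rev, hg, hg'], by rw [G.rev_rev]; exact hgg'.symm⟩)
      exact hS _ h₂ f (mem_next.2 ⟨by rw [tgt_rev, hf, hg'],
        by rw [G.rev_rev, hfe]; exact hge'.symm⟩)
    · exact hS e he f (mem_next.2 ⟨hf, hfe⟩)
  obtain ⟨e, he⟩ := hne
  refine Set.eq_univ_of_forall fun f => ?_
  have all : ∀ v, Relation.ReflTransGen G.Adj (G.tgt e) v → ∀ f, G.src f = v → f ∈ S := by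
    intro v hv
    induction hv with
    | refl => exact step e he
    | tail _ h ih =>
      obtain ⟨a, ha, rfl⟩ := h
      exact step a (ih a ha)
  exact all _ (hG.joined _ _) f rfl

theorem nonempty_edge [Fintype E] {G : SerreGraph V E} [hG : G.Connected]
    (hdeg : ∀ v, 3 ≤ G.degree v) : Nonempty E := by
  obtain ⟨v⟩ := hG.nonempty
  classical
  by_contra h
  rw [not_nonempty_iff] at h
  have := hdeg v
  rw [degree_eq_card, Finset.univ_eq_empty] at this
  simp at this

/-! ### The transfer operator -/

/-- The transfer operator of the non-backtracking walk, with weights `exp (-s * len f)`. -/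
noncomputable def transfer [Fintype E] (G : SerreGraph V E) (d : G.Lengths) (s : ℝ) (x : E → ℝ)
    (e : E) : ℝ :=
  ∑ f ∈ G.next e, Real.exp (-s * d.len f) * x f

theorem continuous_transfer [Fintype E] (G : SerreGraph V E) (d : G.Lengths) (e : E) :
    Continuous fun p : ℝ × (E → ℝ) => G.transfer d p.1 p.2 e := by
  unfold transfer
  fun_prop

theorem transfer_add [Fintype E] (G : SerreGraph V E) (d : G.Lengths) (s : ℝ) (x y : E → ℝ)
    (e : E) : G.transfer d s (x + y) e = G.transfer d s x e + G.transfer d s y e := by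
  simp [transfer, mul_add, Finset.sum_add_distrib]

theorem transfer_smul [Fintype E] (G : SerreGraph V E) (d : G.Lengths) (s a : ℝ) (x : E → ℝ)
    (e : E) : G.transfer d s (a • x) e = a * G.transfer d s x e := by
  simp only [transfer, Finset.mul_sum, Pi.smul_apply, smul_eq_mul]
  exact Finset.sum_congr rfl fun f _ => by ring

theorem transfer_nonneg [Fintype E] (G : SerreGraph V E) (d : G.Lengths) (s : ℝ) {x : E → ℝ}
    (hx : ∀ e, 0 ≤ x e) (e : E) : 0 ≤ G.transfer d s x e :=
  Finset.sum_nonneg fun f _ => mul_nonneg (Real.exp_pos _).le (hx f)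

theorem transfer_pos [Fintype E] (G : SerreGraph V E) (d : G.Lengths) (s : ℝ) {x : E → ℝ}
    (hx : ∀ e, 0 ≤ x e) {e f : E} (hf : f ∈ G.next e) (hxf : 0 < x f) :
    0 < G.transfer d s x e :=
  Finset.sum_pos' (fun f _ => mul_nonneg (Real.exp_pos _).le (hx f))
    ⟨f, hf, mul_pos (Real.exp_pos _) hxf⟩

theorem exists_len_lower_bound [Finite E] {G : SerreGraph V E} (d : G.Lengths) :
    ∃ a > 0, ∀ e, a ≤ d.len e := by
  cases nonempty_fintype E
  cases isEmpty_or_nonempty E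
  · exact ⟨1, one_pos, fun e => isEmptyElim e⟩
  · obtain ⟨e, he⟩ := Finite.exists_min d.len
    exact ⟨_, d.pos e, he⟩

theorem exists_len_upper_bound [Finite E] {G : SerreGraph V E} (d : G.Lengths) :
    ∃ b > 0, ∀ e, d.len e ≤ b := by
  cases nonempty_fintype E
  cases isEmpty_or_nonempty E
  · exact ⟨1, one_pos, fun e => isEmptyElim e⟩
  · obtain ⟨e, he⟩ := Finite.exists_max d.len
    exact ⟨_, d.pos e, he⟩

/-- The parameters of nonzero subinvariant vectors of the transfer operators are bounded. -/
theorem exists_bound_of_le_transfer [Fintype E] [Nonempty E] (G : SerreGraph V E)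
    (d : G.Lengths) : ∃ B, ∀ s x, 0 ≤ s → (∀ e, 0 ≤ x e) → x ≠ 0 →
      (∀ e, x e ≤ G.transfer d s x e) → s ≤ B := by
  obtain ⟨a, ha, hla⟩ := exists_len_lower_bound d
  refine ⟨Real.log (Fintype.card E) / a, fun s x hs hx hx0 hle => ?_⟩
  -- At the largest coordinate, subinvariance gives `exp (s * a) ≤ |E|`, where `a` bounds the
  -- lengths from below.
  obtain ⟨e, he⟩ := Finite.exists_max x
  have hxe : 0 < x e := by
    refine lt_of_le_of_ne (hx e) fun h => hx0 (funext fun f => le_antisymm ?_ (hx f))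
    rw [Pi.zero_apply, h]
    exact he f
  have h₁ : x e ≤ Fintype.card E * (Real.exp (-s * a) * x e) := by
    calc x e ≤ _ := hle e
      _ ≤ ∑ f ∈ G.next e, Real.exp (-s * a) * x e := by
        refine Finset.sum_le_sum fun f _ => mul_le_mul (Real.exp_le_exp.2 ?_) (he f) (hx f)
          (Real.exp_pos _).le
        nlinarith [hla f]
      _ ≤ _ := by
        rw [Finset.sum_const, nsmul_eq_mul]
        exact mul_le_mul_of_nonneg_right (by exact_mod_cast Finset.card_le_univ _)
          (mul_nonneg (Real.exp_pos _).le hxe.le)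
  have h₂ : Real.exp (s * a) ≤ Fintype.card E := by
    rw [← mul_assoc, le_mul_iff_one_le_left hxe, neg_mul, Real.exp_neg, ← div_eq_mul_inv,
      one_le_div (Real.exp_pos _)] at h₁
    exact h₁
  rw [le_div_iff₀ ha, Real.le_log_iff_exp_le (by positivity)]
  exact h₂

/-- If subinvariance were strict at every edge, continuity would allow a larger parameter. If it is
strict only somewhere, adding to `x` its image under the operator spreads the strictness to a
predecessor, so the induction is on the number of edges where equality holds. -/
theorem transfer_eq_self_of_maximal [Fintype E] {G : SerreGraph V E} [G.Connected]
    (hdeg : ∀ v, 3 ≤ G.degree v) (d : G.Lengths) {h : ℝ}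
    (hmax : ∀ s x, h ≤ s → (∀ e, 0 ≤ x e) → x ≠ 0 → (∀ e, x e ≤ G.transfer d s x e) → s ≤ h) :
    ∀ x : E → ℝ, (∀ e, 0 ≤ x e) → x ≠ 0 → (∀ e, x e ≤ G.transfer d h x e) →
      ∀ e, G.transfer d h x e = x e := by
  classical
  intro x
  induction hn : (Finset.univ.filter fun e => G.transfer d h x e = x e).card using
    Nat.strong_induction_on generalizing x with
  | _ n ih =>
  subst hn
  intro hx hx0 hle
  set Z : Set E := {e | G.transfer d h x e = x e} with hZ
  by_cases hZe : Z.Nonempty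
  · by_contra! hne
    obtain ⟨a, ha⟩ := hne
    have : ¬ ∀ e ∈ Z, ∀ f ∈ G.next e, f ∈ Z := fun hc => by
      have := eq_univ_of_closed hdeg hc hZe
      exact ha (this.symm ▸ Set.mem_univ a : a ∈ Z)
    push Not at this
    obtain ⟨e, he, f, hef, hf⟩ := this
    set z : E → ℝ := fun e => G.transfer d h x e - x e with hz
    have hz0 : ∀ e, 0 ≤ z e := fun e => sub_nonneg.2 (hle e)
    -- The defect of `y` is `z` plus the image of `z`. It vanishes only where `z` does, and it is
    -- positive at `e`, because `z f > 0` and `f` follows `e`.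
    set y : E → ℝ := x + G.transfer d h x with hy
    have hyz : ∀ e, G.transfer d h y e = y e + (z e + G.transfer d h z e) := by
      intro e
      have : G.transfer d h x = x + z := by
        funext e
        simp [hz]
      have h2 : G.transfer d h (G.transfer d h x) e =
          G.transfer d h x e + G.transfer d h z e := by
        conv_lhs => rw [this]
        exact G.transfer_add d h x z e
      rw [hy, transfer_add, h2]
      simp only [hz, Pi.add_apply]
      ring
    have hy0 : ∀ e, 0 ≤ y e := fun e => add_nonneg (hx e) (G.transfer_nonneg d h hx e)
    have hyle : ∀ e, y e ≤ G.transfer d h y e := fun e => by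
      rw [hyz]
      linarith [hz0 e, G.transfer_nonneg d h hz0 e]
    have hyne : y ≠ 0 := fun h0 => hx0 (funext fun e => le_antisymm (by
      have h1 := congrFun h0 e
      have h2 := G.transfer_nonneg d h hx e
      simp only [hy, Pi.add_apply, Pi.zero_apply] at h1 ⊢
      linarith) (hx e))
    have hsub : ∀ b, G.transfer d h y b = y b → z b = 0 ∧ G.transfer d h z b = 0 := by
      intro b hb
      rw [hyz] at hb
      constructor <;> linarith [hz0 b, G.transfer_nonneg d h hz0 b]
    have hlt : (Finset.univ.filter fun e => G.transfer d h y e = y e).card <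
        (Finset.univ.filter fun e => G.transfer d h x e = x e).card := by
      refine Finset.card_lt_card (Finset.ssubset_iff_of_subset ?_ |>.2 ⟨e, ?_, ?_⟩)
      · intro b hb
        simp only [Finset.mem_filter, Finset.mem_univ, true_and] at hb ⊢
        exact sub_eq_zero.1 (hsub b hb).1
      · exact Finset.mem_filter.2 ⟨Finset.mem_univ e, he⟩
      · simp only [Finset.mem_filter, Finset.mem_univ, true_and]
        intro hb
        refine (G.transfer_pos d h hz0 hef ?_).ne' (hsub e hb).2
        exact lt_of_le_of_ne (hz0 f) fun h0 => hf (sub_eq_zero.1 h0.symm)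
    have := ih _ hlt y rfl hy0 hyne hyle e
    refine (G.transfer_pos d h hz0 hef ?_).ne' (hsub e this).2
    exact lt_of_le_of_ne (hz0 f) fun h0 => hf (sub_eq_zero.1 h0.symm)
  · exfalso
    have hlt : ∀ e, x e < G.transfer d h x e := fun e =>
      lt_of_le_of_ne (hle e) fun h0 => hZe ⟨e, h0.symm⟩
    have hev : ∀ᶠ s in nhds h, ∀ e, x e < G.transfer d s x e := by
      rw [eventually_all]
      intro e
      have hc : Continuous fun s : ℝ => G.transfer d s x e :=
        (G.continuous_transfer d e).comp (Continuous.prodMk_left x)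
      exact hc.continuousAt.eventually (lt_mem_nhds (hlt e))
    obtain ⟨s, hs, hs'⟩ :=
      ((hev.filter_mono nhdsWithin_le_nhds).and (self_mem_nhdsWithin (s := Set.Ioi h))).exists
    exact absurd (hmax s x (le_of_lt hs') hx hx0 fun e => (hs e).le) (not_le.2 hs')

/-- Perron–Frobenius: for some parameter, the transfer operator has a positive fixed vector. -/
theorem exists_pos_transfer_eq_self [Fintype E] {G : SerreGraph V E} [G.Connected]
    (hdeg : ∀ v, 3 ≤ G.degree v) (d : G.Lengths) :
    ∃ h, 0 ≤ h ∧ ∃ x : E → ℝ, (∀ e, 0 < x e) ∧ ∀ e, G.transfer d h x e = x e := by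
  classical
  have := nonempty_edge hdeg
  obtain ⟨B, hB⟩ := G.exists_bound_of_le_transfer d
  -- Normalized subinvariant vectors together with their parameters form a compact set; the required
  -- `h` is the largest parameter in it.
  set K : Set (ℝ × (E → ℝ)) := (Set.Icc 0 B ×ˢ stdSimplex ℝ E) ∩
    {p | ∀ e, p.2 e ≤ G.transfer d p.1 p.2 e} with hK
  have hnorm : ∀ s x, 0 ≤ s → (∀ e, 0 ≤ x e) → x ≠ 0 → (∀ e, x e ≤ G.transfer d s x e) →
      ∃ y, (s, y) ∈ K := by
    intro s x hs hx hx0 hle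
    have hsum : 0 < ∑ e, x e := by
      obtain ⟨e, he⟩ := Function.ne_iff.1 hx0
      exact Finset.sum_pos' (fun e _ => hx e) ⟨e, Finset.mem_univ e, lt_of_le_of_ne (hx e) he.symm⟩
    refine ⟨(∑ e, x e)⁻¹ • x, ⟨⟨⟨hs, hB s x hs hx hx0 hle⟩, fun e => ?_, ?_⟩, fun e => ?_⟩⟩
    · exact mul_nonneg (inv_nonneg.2 hsum.le) (hx e)
    · simp only [Pi.smul_apply, smul_eq_mul, ← Finset.mul_sum]
      exact inv_mul_cancel₀ hsum.ne'
    · simp only [transfer_smul, Pi.smul_apply, smul_eq_mul]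
      exact mul_le_mul_of_nonneg_left (hle e) (inv_nonneg.2 hsum.le)
  have hcomp : IsCompact K := by
    refine (isCompact_Icc.prod (isCompact_stdSimplex ℝ E)).inter_right ?_
    simp only [Set.ofPred_forall]
    exact isClosed_iInter fun e => isClosed_le (by fun_prop) (G.continuous_transfer d e)
  -- At parameter zero a constant vector is subinvariant, since every edge has at least two
  -- successors.
  have hne : K.Nonempty := by
    obtain ⟨y, hy⟩ := hnorm 0 (fun _ => 1) le_rfl (fun _ => zero_le_one)
      (fun h => one_ne_zero (congrFun h (Classical.arbitrary E))) (fun e => by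
        simp only [transfer, neg_zero, zero_mul, Real.exp_zero, mul_one, Finset.sum_const,
          nsmul_eq_mul, card_next]
        linarith [two_le_branching hdeg (G.tgt e)])
    exact ⟨_, hy⟩
  obtain ⟨⟨h, x⟩, hxK, hmax⟩ := hcomp.exists_isMaxOn hne continuous_fst.continuousOn
  obtain ⟨⟨⟨hh0, -⟩, hx, hx1⟩, hle⟩ := hxK
  have hx0 : x ≠ 0 := by
    rintro rfl
    simp at hx1
  have heig := transfer_eq_self_of_maximal hdeg d (h := h) (fun s x hs hx hx0 hle => by
    obtain ⟨y, hy⟩ := hnorm s x (hh0.trans hs) hx hx0 hle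
    exact hmax hy) x hx hx0 hle
  refine ⟨h, hh0, x, fun e => lt_of_le_of_ne (hx e) fun he => hx0 ?_, heig⟩
  -- The zero set of a nonnegative fixed vector is closed under successors, so by irreducibility one
  -- zero would make the vector vanish.
  have := eq_univ_of_closed hdeg (S := {e | x e = 0}) (fun a ha b hb => by
    by_contra hb'
    refine (G.transfer_pos d h hx hb (lt_of_le_of_ne (hx b) (Ne.symm hb'))).ne' ?_
    rw [heig a]
    exact ha) ⟨e, he.symm⟩
  exact funext fun f => (this.symm ▸ Set.mem_univ f : f ∈ {e | x e = 0})

/-! ### The minimal entropy -/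

/-- The entropy of the non-backtracking walk with uniform transition probabilities. -/
noncomputable def walkEntropy [Fintype E] (G : SerreGraph V E) : ℝ :=
  (∑ e, Real.log (G.branching (G.tgt e))) / 2

theorem walkEntropy_pos [Fintype E] [Nonempty E] {G : SerreGraph V E}
    (hdeg : ∀ v, 3 ≤ G.degree v) : 0 < G.walkEntropy :=
  half_pos (Finset.sum_pos (fun e _ => Real.log_pos (by
    linarith [two_le_branching hdeg (G.tgt e)])) Finset.univ_nonempty)

theorem sum_comp_rev [Fintype E] (G : SerreGraph V E) (g : E → ℝ) :
    ∑ e, g (G.rev e) = ∑ e, g e :=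
  Equiv.sum_comp (Function.Involutive.toPerm G.rev G.rev_rev) g

/-- The density of the transition probabilities of the walk associated with a fixed vector of the
transfer operator with respect to the uniform transition probabilities. -/
noncomputable def transitionRatio (G : SerreGraph V E) (d : G.Lengths) (h : ℝ) (x : E → ℝ)
    (e f : E) : ℝ :=
  G.branching (G.tgt e) * (Real.exp (-h * d.len f) * x f) / x e

section

variable {G : SerreGraph V E} {d : G.Lengths} {h : ℝ} {x : E → ℝ}

theorem transitionRatio_pos (hdeg : ∀ v, 3 ≤ G.degree v) (hx : ∀ e, 0 < x e) (e f : E) :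
    0 < G.transitionRatio d h x e f :=
  div_pos (mul_pos (by linarith [two_le_branching hdeg (G.tgt e)])
    (mul_pos (Real.exp_pos _) (hx f))) (hx e)

theorem log_transitionRatio (hdeg : ∀ v, 3 ≤ G.degree v) (hx : ∀ e, 0 < x e) (e f : E) :
    Real.log (G.transitionRatio d h x e f) = Real.log (G.branching (G.tgt e)) -
      Real.log (x e) + (-h * d.len f + Real.log (x f)) := by
  have hq : G.branching (G.tgt e) ≠ 0 := by linarith [two_le_branching hdeg (G.tgt e)]
  rw [transitionRatio, Real.log_div (mul_ne_zero hq (mul_ne_zero (Real.exp_pos _).ne' (hx f).ne'))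
    (hx e).ne', Real.log_mul hq (mul_ne_zero (Real.exp_pos _).ne' (hx f).ne'),
    Real.log_mul (Real.exp_pos _).ne' (hx f).ne', Real.log_exp]
  ring

variable [Fintype E]

/-- The eigenvector equation says that the transition probabilities of the walk defined by `x` sum
to one, so their ratios to the uniform probabilities have mean one. -/
theorem sum_transitionRatio_sub_one (hx : ∀ e, 0 < x e) (heig : ∀ e, G.transfer d h x e = x e)
    (e : E) : ∑ f ∈ G.next e, (G.transitionRatio d h x e f - 1) = 0 := by
  have h₁ : ∑ f ∈ G.next e, G.transitionRatio d h x e f =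
      G.branching (G.tgt e) * G.transfer d h x e / x e := by
    simp only [transitionRatio, transfer, Finset.mul_sum, Finset.sum_div]
  rw [Finset.sum_sub_distrib, h₁, heig, mul_div_assoc, div_self (hx e).ne', Finset.sum_const,
    nsmul_eq_mul, card_next]
  ring

/-- The sum is minus a relative entropy. The two contributions of `log x` cancel by stationarity of
the uniform measure, which also turns the average of the lengths of the successors into the total
length. -/
theorem sum_log_transitionRatio (hdeg : ∀ v, 3 ≤ G.degree v) (hx : ∀ e, 0 < x e) :
    ∑ e, (G.branching (G.tgt e))⁻¹ * ∑ f ∈ G.next e, Real.log (G.transitionRatio d h x e f) =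
      2 * (G.walkEntropy - h * G.totalLength d) := by
  have h₁ : ∀ e, (G.branching (G.tgt e))⁻¹ *
      ∑ f ∈ G.next e, Real.log (G.transitionRatio d h x e f) =
      (Real.log (G.branching (G.tgt e)) - Real.log (x e)) +
        (G.branching (G.tgt e))⁻¹ * ∑ f ∈ G.next e, (-h * d.len f + Real.log (x f)) := by
    intro e
    have hq : G.branching (G.tgt e) ≠ 0 := by linarith [two_le_branching hdeg (G.tgt e)]
    simp only [log_transitionRatio hdeg hx]
    rw [Finset.sum_add_distrib, Finset.sum_const, nsmul_eq_mul, card_next, mul_add, ← mul_assoc,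
      inv_mul_cancel₀ hq, one_mul]
  simp only [h₁]
  rw [Finset.sum_add_distrib, sum_branching_inv_mul_sum_next G hdeg, Finset.sum_sub_distrib,
    Finset.sum_add_distrib, ← Finset.mul_sum, walkEntropy, totalLength]
  ring

theorem branching_inv_mul_sum_log_nonpos (hdeg : ∀ v, 3 ≤ G.degree v) (hx : ∀ e, 0 < x e)
    (heig : ∀ e, G.transfer d h x e = x e) (e : E) :
    (G.branching (G.tgt e))⁻¹ *
      ∑ f ∈ G.next e, Real.log (G.transitionRatio d h x e f) ≤ 0 := by
  refine mul_nonpos_of_nonneg_of_nonpos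
    (inv_nonneg.2 (by linarith [two_le_branching hdeg (G.tgt e)])) ?_
  rw [← sum_transitionRatio_sub_one hx heig e]
  exact Finset.sum_le_sum fun f _ => Real.log_le_sub_one_of_pos (transitionRatio_pos hdeg hx e f)

theorem walkEntropy_le (hdeg : ∀ v, 3 ≤ G.degree v) (hx : ∀ e, 0 < x e)
    (heig : ∀ e, G.transfer d h x e = x e) : G.walkEntropy ≤ h * G.totalLength d := by
  have h₁ := sum_log_transitionRatio (d := d) (h := h) hdeg hx
  have h₂ := Finset.sum_nonpos fun e (_ : e ∈ Finset.univ) =>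
    branching_inv_mul_sum_log_nonpos hdeg hx heig e
  linarith

/-- A vanishing sum of nonpositive terms has vanishing terms, and `log t = t - 1` only for `t = 1`.
-/
theorem transitionRatio_eq_one (hdeg : ∀ v, 3 ≤ G.degree v) (hx : ∀ e, 0 < x e)
    (heig : ∀ e, G.transfer d h x e = x e) (heq : G.walkEntropy = h * G.totalLength d) {e f : E}
    (hf : f ∈ G.next e) : G.transitionRatio d h x e f = 1 := by
  have h₁ := sum_log_transitionRatio (d := d) (h := h) hdeg hx
  rw [heq, sub_self, mul_zero] at h₁
  have h₂ := (Finset.sum_eq_zero_iff_of_nonpos fun a _ =>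
    branching_inv_mul_sum_log_nonpos hdeg hx heig a).1 h₁ e (Finset.mem_univ e)
  have hq : (G.branching (G.tgt e))⁻¹ ≠ 0 :=
    inv_ne_zero (by linarith [two_le_branching hdeg (G.tgt e)])
  have h₃ := (mul_eq_zero.1 h₂).resolve_left hq
  have h₄ : ∀ f ∈ G.next e, Real.log (G.transitionRatio d h x e f) ≤
      G.transitionRatio d h x e f - 1 :=
    fun f _ => Real.log_le_sub_one_of_pos (transitionRatio_pos hdeg hx e f)
  have h₅ := (Finset.sum_eq_sum_iff_of_le h₄).1
    (h₃.trans (sum_transitionRatio_sub_one hx heig e).symm) f hf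
  by_contra hne
  exact (Real.log_lt_sub_one_of_pos (transitionRatio_pos hdeg hx e f) hne).ne h₅

/-- Rigidity: if the entropy of the uniform walk equals the entropy of the metric, then the edge
lengths are determined by the degrees. -/
theorem mul_len_eq_of_walkEntropy_eq (hdeg : ∀ v, 3 ≤ G.degree v) (hx : ∀ e, 0 < x e)
    (heig : ∀ e, G.transfer d h x e = x e) (heq : G.walkEntropy = h * G.totalLength d) (f : E) :
    h * d.len f =
      (Real.log (G.branching (G.src f)) + Real.log (G.branching (G.tgt f))) / 2 := by
  have key : ∀ e f, f ∈ G.next e → Real.log (x e) =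
      Real.log (G.branching (G.tgt e)) + (-h * d.len f + Real.log (x f)) := by
    intro e f hf
    have := log_transitionRatio (d := d) (h := h) hdeg hx e f
    rw [transitionRatio_eq_one hdeg hx heig heq hf, Real.log_one] at this
    linarith
  set c : E → ℝ := fun f => -h * d.len f + Real.log (x f) with hc
  -- Two edges with the same origin have a common predecessor, namely the reverse of a third edge
  -- there; this uses degree at least three. So `c` is a function of the origin.
  have hconst : ∀ f g, G.src f = G.src g → c f = c g := by
    intro f g hfg
    obtain ⟨a, ha, haf, hag⟩ := exists_src_eq_ne_ne hdeg (G.src f) f g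
    have h₁ := key (G.rev a) f (mem_next.2 ⟨by rw [tgt_rev, ha], by rw [G.rev_rev]; exact haf.symm⟩)
    have h₂ := key (G.rev a) g
      (mem_next.2 ⟨by rw [tgt_rev, ha, hfg], by rw [G.rev_rev]; exact hag.symm⟩)
    simp only [hc]
    linarith
  have hlog : ∀ f, h * d.len f = Real.log (G.branching (G.tgt f)) + c (G.rev f) - c f := by
    intro f
    obtain ⟨g, hg, hgf, -⟩ := exists_src_eq_ne_ne hdeg (G.tgt f) (G.rev f) f
    have h₁ := key f g (mem_next.2 ⟨hg, hgf⟩)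
    have h₂ := hconst g (G.rev f) hg
    simp only [hc] at h₂ ⊢
    linarith
  -- Adding the formulas for `f` and `G.rev f` cancels the unknown `c`.
  have h₁ := hlog f
  have h₂ := hlog (G.rev f)
  rw [G.rev_rev, tgt_rev, d.len_rev] at h₂
  linarith

end

/-- Lim's metric: the length of an edge is proportional to the sum of the logarithms of the
branching numbers of its ends. -/
noncomputable def limLengths [Fintype E] [Nonempty E] (G : SerreGraph V E)
    (hdeg : ∀ v, 3 ≤ G.degree v) : G.Lengths where
  len e := (Real.log (G.branching (G.src e)) + Real.log (G.branching (G.tgt e))) / 2 /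
    G.walkEntropy
  pos e := div_pos (half_pos (add_pos
    (Real.log_pos (by linarith [two_le_branching hdeg (G.src e)]))
    (Real.log_pos (by linarith [two_le_branching hdeg (G.tgt e)])))) (walkEntropy_pos hdeg)
  len_rev e := by
    rw [tgt_rev, add_comm]
    rfl

theorem totalLength_limLengths [Fintype E] [Nonempty E] (G : SerreGraph V E)
    (hdeg : ∀ v, 3 ≤ G.degree v) : G.totalLength (G.limLengths hdeg) = 1 := by
  have h := (walkEntropy_pos hdeg).ne'
  have h₁ : ∑ e, Real.log (G.branching (G.src e)) = ∑ e, Real.log (G.branching (G.tgt e)) := by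
    rw [← sum_comp_rev]
    rfl
  simp only [totalLength, limLengths]
  rw [← Finset.sum_div, ← Finset.sum_div, Finset.sum_add_distrib, h₁]
  have hs : ∑ e, Real.log (G.branching (G.tgt e)) = 2 * G.walkEntropy := by
    rw [walkEntropy]
    ring
  rw [hs]
  field_simp
  norm_num

/-- With these lengths each summand equals `1 / √q`, where `q` is the branching at the end of `e`.
There are `q` successors, and `q / √q = √q`. -/
theorem transfer_limLengths [Fintype E] [Nonempty E] (G : SerreGraph V E)
    (hdeg : ∀ v, 3 ≤ G.degree v) (e : E) :
    G.transfer (G.limLengths hdeg) G.walkEntropy (fun f => Real.sqrt (G.branching (G.tgt f))) e =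
      Real.sqrt (G.branching (G.tgt e)) := by
  have hw := (walkEntropy_pos hdeg).ne'
  have hq : ∀ v, 0 < G.branching v := fun v => by linarith [two_le_branching hdeg v]
  have h₁ : ∀ f ∈ G.next e, Real.exp (-G.walkEntropy * (G.limLengths hdeg).len f) *
      Real.sqrt (G.branching (G.tgt f)) = (Real.sqrt (G.branching (G.tgt e)))⁻¹ := by
    intro f hf
    have h₂ : -G.walkEntropy * (G.limLengths hdeg).len f =
        -(Real.log (Real.sqrt (G.branching (G.tgt e))) +
          Real.log (Real.sqrt (G.branching (G.tgt f)))) := by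
      rw [Real.log_sqrt (hq _).le, Real.log_sqrt (hq _).le, ← (mem_next.1 hf).1]
      simp only [limLengths]
      field_simp
    rw [h₂, Real.exp_neg, Real.exp_add, Real.exp_log (Real.sqrt_pos.2 (hq _)),
      Real.exp_log (Real.sqrt_pos.2 (hq _)), mul_inv, mul_assoc,
      inv_mul_cancel₀ (Real.sqrt_pos.2 (hq _)).ne', mul_one]
  rw [transfer, Finset.sum_congr rfl h₁, Finset.sum_const, nsmul_eq_mul, card_next,
    ← div_eq_mul_inv, Real.div_sqrt]

theorem eq_limLengths [Fintype E] [Nonempty E] {G : SerreGraph V E}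
    (hdeg : ∀ v, 3 ≤ G.degree v) {d : G.Lengths} {x : E → ℝ} (hx : ∀ e, 0 < x e)
    (heig : ∀ e, G.transfer d G.walkEntropy x e = x e) (hd : G.totalLength d = 1) :
    d = G.limLengths hdeg := by
  ext f
  have := mul_len_eq_of_walkEntropy_eq hdeg hx heig (by rw [hd, mul_one]) f
  simp only [limLengths]
  rw [← this, mul_div_cancel_left₀ _ (walkEntropy_pos hdeg).ne']

/-! ### Counting reduced paths -/

/-- The length of an edge path. -/
noncomputable def pathLength {G : SerreGraph V E} (d : G.Lengths) (w : List E) : ℝ :=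
  (w.map d.len).sum

theorem pathLength_nil {G : SerreGraph V E} (d : G.Lengths) : pathLength d [] = 0 := rfl

theorem pathLength_cons {G : SerreGraph V E} (d : G.Lengths) (e : E) (w : List E) :
    pathLength d (e :: w) = d.len e + pathLength d w := by
  simp [pathLength]

theorem length_mul_le_pathLength {G : SerreGraph V E} (d : G.Lengths) {a : ℝ}
    (ha : ∀ e, a ≤ d.len e) (w : List E) : w.length * a ≤ pathLength d w := by
  induction w with
  | nil => simp [pathLength_nil]
  | cons e w ih =>
    rw [pathLength_cons, List.length_cons]
    push_cast
    linarith [ha e]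

theorem finite_setOf_pathLength_le [Finite E] {G : SerreGraph V E} (d : G.Lengths) (v₀ : V)
    (r : ℝ) : {w | G.IsReducedPath v₀ w ∧ pathLength d w ≤ r}.Finite := by
  obtain ⟨a, ha, hla⟩ := exists_len_lower_bound d
  refine (List.finite_length_le E ⌊r / a⌋₊).subset fun w hw => ?_
  refine Nat.le_floor ?_
  rw [le_div_iff₀ ha]
  exact (length_mul_le_pathLength d hla w).trans hw.2

/-- The finite set of the reduced paths from `v₀` of length at most `r`. -/
noncomputable def shortPaths [Finite E] {G : SerreGraph V E} (d : G.Lengths) (v₀ : V) (r : ℝ) :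
    Finset (List E) :=
  (finite_setOf_pathLength_le d v₀ r).toFinset

theorem mem_shortPaths [Finite E] {G : SerreGraph V E} {d : G.Lengths} {v₀ : V} {r : ℝ}
    {w : List E} : w ∈ shortPaths d v₀ r ↔ G.IsReducedPath v₀ w ∧ pathLength d w ≤ r := by
  simp [shortPaths]

open Classical in
/-- The edges by which a reduced path can be extended. -/
noncomputable def extensions [Fintype E] (G : SerreGraph V E) (v₀ : V) (w : List E) : Finset E :=
  {e | G.src e = G.endpoint v₀ w ∧ w.head? ≠ some (G.rev e)}

theorem mem_extensions [Fintype E] {G : SerreGraph V E} {v₀ : V} {w : List E} {e : E} :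
    e ∈ G.extensions v₀ w ↔ G.src e = G.endpoint v₀ w ∧ w.head? ≠ some (G.rev e) := by
  simp [extensions]

theorem extensions_cons [Fintype E] (G : SerreGraph V E) (v₀ : V) (w : List E) (e : E) :
    G.extensions v₀ (e :: w) = G.next e := by
  ext f
  simp only [mem_extensions, mem_next, endpoint, List.head?_cons, ne_eq, Option.some.injEq]
  refine and_congr_right fun _ => not_congr ⟨?_, ?_⟩
  · rintro rfl
    rw [G.rev_rev]
  · rintro rfl
    rw [G.rev_rev]

open Classical in
theorem two_le_card_extensions [Fintype E] {G : SerreGraph V E} (hdeg : ∀ v, 3 ≤ G.degree v)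
    (v₀ : V) (w : List E) : 2 ≤ (G.extensions v₀ w).card := by
  cases w with
  | nil =>
    have : G.extensions v₀ [] = Finset.univ.filter fun e => G.src e = v₀ := by
      ext e
      simp [mem_extensions, endpoint]
    rw [this, ← degree_eq_card]
    exact (by norm_num : 2 ≤ 3).trans (hdeg v₀)
  | cons e w =>
    rw [extensions_cons]
    have := two_le_branching hdeg (G.tgt e)
    rw [← card_next] at this
    exact_mod_cast this

open Classical in
/-- The reduced paths from `v₀` longer than `r` that are no longer so without their last edge. -/
noncomputable def crossingPaths [Fintype E] {G : SerreGraph V E} (d : G.Lengths) (v₀ : V)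
    (r : ℝ) : Finset (List E) :=
  (((shortPaths d v₀ r).sigma fun w => G.extensions v₀ w).image fun p => p.2 :: p.1).filter
    fun w => r < pathLength d w

section

variable [Fintype E] {G : SerreGraph V E} {d : G.Lengths} {v₀ : V} {r : ℝ}

theorem exists_of_mem_crossingPaths {w : List E} (hw : w ∈ crossingPaths d v₀ r) :
    ∃ e u, w = e :: u ∧ G.IsReducedPath v₀ w ∧ pathLength d u ≤ r ∧ r < pathLength d w := by
  classical
  simp only [crossingPaths, Finset.mem_filter, Finset.mem_image, Finset.mem_sigma,
    mem_shortPaths, mem_extensions] at hw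
  obtain ⟨⟨⟨u, e⟩, ⟨hu, he⟩, rfl⟩, hr⟩ := hw
  exact ⟨e, u, rfl, ⟨he.1, he.2, hu.1⟩, hu.2, hr⟩

open Classical in
-- A nonempty reduced path extends exactly one path, its truncation. An extension of a short path is
-- either again short, hence a nonempty short path, or crosses the level `r`.
theorem sum_extensions_shortPaths (g : List E → ℝ) :
    ∑ w ∈ shortPaths d v₀ r, ∑ e ∈ G.extensions v₀ w, g (e :: w) =
      ∑ w ∈ (shortPaths d v₀ r).erase [], g w + ∑ w ∈ crossingPaths d v₀ r, g w := by
  set M := ((shortPaths d v₀ r).sigma fun w => G.extensions v₀ w).image fun p => p.2 :: p.1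
    with hM
  have h₁ : ∑ w ∈ shortPaths d v₀ r, ∑ e ∈ G.extensions v₀ w, g (e :: w) = ∑ w ∈ M, g w := by
    rw [Finset.sum_sigma', hM, Finset.sum_image]
    rintro ⟨w, e⟩ _ ⟨w', e'⟩ _ h
    simp only [List.cons.injEq] at h
    obtain ⟨rfl, rfl⟩ := h
    rfl
  have h₂ : (M.filter fun w => ¬ r < pathLength d w) = (shortPaths d v₀ r).erase [] := by
    ext w
    simp only [hM, Finset.mem_filter, Finset.mem_image, Finset.mem_sigma, Finset.mem_erase,
      mem_shortPaths, mem_extensions, not_lt]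
    constructor
    · rintro ⟨⟨⟨u, e⟩, ⟨hu, he⟩, rfl⟩, hr⟩
      exact ⟨List.cons_ne_nil _ _, ⟨he.1, he.2, hu.1⟩, hr⟩
    · rintro ⟨hne, hw, hr⟩
      cases w with
      | nil => exact absurd rfl hne
      | cons e u =>
        refine ⟨⟨⟨u, e⟩, ⟨⟨hw.2.2, ?_⟩, hw.1, hw.2.1⟩, rfl⟩, hr⟩
        rw [pathLength_cons] at hr
        linarith [d.pos e]
  rw [h₁, ← h₂, add_comm, crossingPaths, ← hM, Finset.sum_filter_add_sum_filter_not]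

theorem nil_mem_shortPaths (hr : 0 ≤ r) : [] ∈ shortPaths d v₀ r :=
  mem_shortPaths.2 ⟨trivial, hr⟩

/-- A tree in which each of the `N` inner nodes has at least two children has more than `N` leaves:
`2 * N` is at most `N - 1` plus the number of leaves. -/
theorem card_shortPaths_le_card_crossingPaths (hdeg : ∀ v, 3 ≤ G.degree v) (hr : 0 ≤ r) :
    (shortPaths d v₀ r).card ≤ (crossingPaths d v₀ r).card := by
  classical
  have h := sum_extensions_shortPaths (d := d) (v₀ := v₀) (r := r) fun _ => 1
  simp only [Finset.sum_const, nsmul_eq_mul, mul_one] at h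
  have h₁ : (shortPaths d v₀ r).card * 2 ≤ ∑ w ∈ shortPaths d v₀ r, (G.extensions v₀ w).card := by
    rw [← smul_eq_mul, ← Finset.sum_const]
    exact Finset.sum_le_sum fun w _ => two_le_card_extensions hdeg v₀ w
  have h₂ : ∑ w ∈ shortPaths d v₀ r, (G.extensions v₀ w).card =
      ((shortPaths d v₀ r).erase []).card + (crossingPaths d v₀ r).card := by exact_mod_cast h
  have h₃ := Finset.card_erase_add_one (nil_mem_shortPaths (d := d) (v₀ := v₀) hr)
  omega

theorem crossingPaths_subset {b : ℝ} (hb : ∀ e, d.len e ≤ b) :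
    crossingPaths d v₀ r ⊆ shortPaths d v₀ (r + b) := by
  intro w hw
  obtain ⟨e, u, rfl, hred, hu, -⟩ := exists_of_mem_crossingPaths hw
  refine mem_shortPaths.2 ⟨hred, ?_⟩
  rw [pathLength_cons]
  linarith [hb e]

end

/-- The mass that a fixed vector `x` of the transfer operator gives to a reduced path. -/
noncomputable def pathMass [Fintype E] (G : SerreGraph V E) (d : G.Lengths) (v₀ : V) (h : ℝ)
    (x : E → ℝ) : List E → ℝ
  | [] => ∑ e ∈ G.extensions v₀ [], Real.exp (-h * d.len e) * x e
  | e :: w => Real.exp (-h * pathLength d (e :: w)) * x e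

section

variable [Fintype E] {G : SerreGraph V E} {d : G.Lengths} {v₀ : V} {h : ℝ} {x : E → ℝ}

/-- Conservation of the flow: for a nonempty path this is the eigenvector equation, and at the root
it is the definition of the mass. -/
theorem sum_pathMass_extensions (heig : ∀ e, G.transfer d h x e = x e) (w : List E) :
    ∑ e ∈ G.extensions v₀ w, G.pathMass d v₀ h x (e :: w) = G.pathMass d v₀ h x w := by
  cases w with
  | nil => simp [pathMass, pathLength]
  | cons e w =>
    simp only [extensions_cons, pathMass]
    conv_rhs => rw [← heig e, transfer, Finset.mul_sum]
    refine Finset.sum_congr rfl fun f _ => ?_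
    rw [pathLength_cons d f, mul_add, Real.exp_add]
    ring

/-- The crossing paths form a cut between the root and infinity, so all of the conserved mass passes
through them. -/
theorem sum_pathMass_crossingPaths (heig : ∀ e, G.transfer d h x e = x e) {r : ℝ} (hr : 0 ≤ r) :
    ∑ w ∈ crossingPaths d v₀ r, G.pathMass d v₀ h x w = G.pathMass d v₀ h x [] := by
  classical
  have h₁ := sum_extensions_shortPaths (d := d) (v₀ := v₀) (r := r) (G.pathMass d v₀ h x)
  simp only [sum_pathMass_extensions heig] at h₁
  have h₂ := Finset.sum_erase_add _ (G.pathMass d v₀ h x)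
    (nil_mem_shortPaths (d := d) (v₀ := v₀) hr)
  linarith

theorem pathMass_nil_pos (hdeg : ∀ v, 3 ≤ G.degree v) (hx : ∀ e, 0 < x e) :
    0 < G.pathMass d v₀ h x [] :=
  Finset.sum_pos (fun e _ => mul_pos (Real.exp_pos _) (hx e))
    (Finset.card_pos.1 (lt_of_lt_of_le two_pos (two_le_card_extensions hdeg v₀ [])))

/-- The number of reduced paths of length at most `r` grows at most like `exp (h * r)`. -/
theorem exists_card_shortPaths_le (hdeg : ∀ v, 3 ≤ G.degree v) (hh : 0 ≤ h)
    (hx : ∀ e, 0 < x e) (heig : ∀ e, G.transfer d h x e = x e) :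
    ∃ C > 0, ∀ r, 0 ≤ r → ((shortPaths d v₀ r).card : ℝ) ≤ C * Real.exp (h * r) := by
  obtain ⟨e₀, -⟩ := Finset.card_pos.1
    (lt_of_lt_of_le two_pos (two_le_card_extensions hdeg v₀ []))
  obtain ⟨b, -, hb⟩ := exists_len_upper_bound d
  have : Nonempty E := ⟨e₀⟩
  obtain ⟨a, ha⟩ := Finite.exists_min x
  refine ⟨G.pathMass d v₀ h x [] / x a * Real.exp (h * b),
    mul_pos (div_pos (pathMass_nil_pos hdeg hx) (hx a)) (Real.exp_pos _), fun r hr => ?_⟩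
  -- A crossing path has length at most `r + b`, which bounds its mass from below by the least
  -- coordinate `x a`.
  have h₁ : (crossingPaths d v₀ r).card * (Real.exp (-h * (r + b)) * x a) ≤
      G.pathMass d v₀ h x [] := by
    rw [← sum_pathMass_crossingPaths heig hr, ← nsmul_eq_mul, ← Finset.sum_const]
    refine Finset.sum_le_sum fun w hw => ?_
    obtain ⟨e, u, rfl, hred, hu, -⟩ := exists_of_mem_crossingPaths hw
    refine mul_le_mul (Real.exp_le_exp.2 ?_) (ha e) (hx a).le (Real.exp_pos _).le
    rw [pathLength_cons]
    nlinarith [hb e]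
  have h₂ : ((shortPaths d v₀ r).card : ℝ) ≤ (crossingPaths d v₀ r).card := by
    exact_mod_cast card_shortPaths_le_card_crossingPaths hdeg hr
  refine h₂.trans ?_
  rw [← le_div_iff₀ (mul_pos (Real.exp_pos _) (hx a))] at h₁
  refine h₁.trans (le_of_eq ?_)
  rw [neg_mul, Real.exp_neg, mul_add, Real.exp_add]
  field_simp

/-- The number of reduced paths of length at most `r` grows at least like `exp (h * r)`. -/
theorem exists_le_card_shortPaths (hdeg : ∀ v, 3 ≤ G.degree v) (hh : 0 ≤ h)
    (hx : ∀ e, 0 < x e) (heig : ∀ e, G.transfer d h x e = x e) :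
    ∃ c > 0, ∀ᶠ r in atTop, c * Real.exp (h * r) ≤ ((shortPaths d v₀ r).card : ℝ) := by
  obtain ⟨e₀, -⟩ := Finset.card_pos.1
    (lt_of_lt_of_le two_pos (two_le_card_extensions hdeg v₀ []))
  obtain ⟨b, -, hb⟩ := exists_len_upper_bound d
  have : Nonempty E := ⟨e₀⟩
  obtain ⟨a, ha⟩ := Finite.exists_max x
  refine ⟨G.pathMass d v₀ h x [] / x a * Real.exp (-(h * b)),
    mul_pos (div_pos (pathMass_nil_pos hdeg hx) (hx a)) (Real.exp_pos _),
    (eventually_ge_atTop b).mono fun r hr => ?_⟩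
  -- Cutting at level `r - b` keeps the crossing paths within length `r`.
  have hr' : 0 ≤ r - b := sub_nonneg.2 hr
  have h₁ : G.pathMass d v₀ h x [] ≤
      (crossingPaths d v₀ (r - b)).card * (Real.exp (-h * (r - b)) * x a) := by
    rw [← sum_pathMass_crossingPaths heig hr', ← nsmul_eq_mul, ← Finset.sum_const]
    refine Finset.sum_le_sum fun w hw => ?_
    obtain ⟨e, u, rfl, hred, -, hu⟩ := exists_of_mem_crossingPaths hw
    refine mul_le_mul (Real.exp_le_exp.2 ?_) (ha e) (hx e).le (Real.exp_pos _).le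
    nlinarith
  have h₂ : ((crossingPaths d v₀ (r - b)).card : ℝ) ≤ (shortPaths d v₀ r).card := by
    have := Finset.card_le_card (crossingPaths_subset (v₀ := v₀) (r := r - b) hb)
    rw [sub_add_cancel] at this
    exact_mod_cast this
  refine le_trans ?_ h₂
  rw [← div_le_iff₀ (mul_pos (Real.exp_pos _) (hx a))] at h₁
  refine (le_of_eq ?_).trans h₁
  rw [neg_mul, Real.exp_neg, Real.exp_neg, mul_sub, Real.exp_sub]
  field_simp

end

/-! ### Lipschitz functions on metric graphs -/

section

variable {G : SerreGraph V E} [G.Connected] {d : G.Lengths}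

theorem dist_le_of_pathCost {x y : Piece G d} {c : ℝ} (h : PathCost G d x y c) : dist x y ≤ c :=
  csInf_le (bddBelow_pathCost G d x y) h

/-- A function on the pieces that is compatible with the gluing and `1`-Lipschitz on edges is
`1`-Lipschitz. -/
theorem abs_sub_le_dist {F : Piece G d → ℝ}
    (hseg : ∀ e s t hs₀ hs₁ ht₀ ht₁, |F (.onEdge e s hs₀ hs₁) - F (.onEdge e t ht₀ ht₁)| ≤ |s - t|)
    (hflip : ∀ e s t hs₀ hs₁ ht₀ ht₁, s + t = d.len e →
      F (.onEdge e s hs₀ hs₁) = F (.onEdge (G.rev e) t ht₀ ht₁))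
    (horigin : ∀ e h₁, F (.onEdge e 0 le_rfl h₁) = F (.vertex (G.src e))) (x y : Piece G d) :
    |F x - F y| ≤ dist x y := by
  refine le_csInf (exists_pathCost G d x y) fun c hc => ?_
  induction hc with
  | refl => simp
  | segment e s t hs₀ hs₁ ht₀ ht₁ => exact hseg e s t hs₀ hs₁ ht₀ ht₁
  | flip e s t hs₀ hs₁ ht₀ ht₁ hst => rw [hflip e s t hs₀ hs₁ ht₀ ht₁ hst, sub_self, abs_zero]
  | origin e h₁ => rw [horigin, sub_self, abs_zero]
  | symm _ ih => rwa [abs_sub_comm]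
  | trans _ _ ih₁ ih₂ => exact (abs_sub_le _ _ _).trans (add_le_add ih₁ ih₂)

/-- The affine extension to the edges of a function on the vertices. -/
noncomputable def affineExtension (ψ : V → ℝ) : Piece G d → ℝ
  | .vertex v => ψ v
  | .onEdge e t _ _ => ψ (G.src e) + t / d.len e * (ψ (G.tgt e) - ψ (G.src e))

theorem abs_affineExtension_sub_le {ψ : V → ℝ}
    (hψ : ∀ e, |ψ (G.tgt e) - ψ (G.src e)| ≤ d.len e) (x y : Piece G d) :
    |affineExtension ψ x - affineExtension ψ y| ≤ dist x y := by
  refine abs_sub_le_dist ?_ ?_ ?_ x y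
  · intro e s t _ _ _ _
    have h : (ψ (G.src e) + s / d.len e * (ψ (G.tgt e) - ψ (G.src e))) -
        (ψ (G.src e) + t / d.len e * (ψ (G.tgt e) - ψ (G.src e))) =
        (s - t) * ((ψ (G.tgt e) - ψ (G.src e)) / d.len e) := by ring
    simp only [affineExtension]
    rw [h, abs_mul, abs_div, abs_of_pos (d.pos e)]
    exact mul_le_of_le_one_right (abs_nonneg _) ((div_le_one (d.pos e)).2 (hψ e))
  · intro e s t _ _ _ _ hst
    have := (d.pos e).ne'
    simp only [affineExtension, d.len_rev, tgt_rev]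
    rw [show G.src (G.rev e) = G.tgt e from rfl, eq_sub_of_add_eq hst]
    field_simp
    ring
  · intro e _
    simp [affineExtension]

/-- This gives lower bounds for distances without geodesics; it is used with the path length from
the root and with the combinatorial distance. -/
theorem abs_sub_le_dist_vertex {ψ : V → ℝ}
    (hψ : ∀ e, |ψ (G.tgt e) - ψ (G.src e)| ≤ d.len e) (u v : V) :
    |ψ u - ψ v| ≤ dist (MetricGraph.vertex G d u) (MetricGraph.vertex G d v) :=
  abs_affineExtension_sub_le hψ (.vertex u) (.vertex v)

/-- The parametrization of an edge of a metric graph, extended constantly to the real line. -/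
noncomputable def edgeMap (d : G.Lengths) (e : E) (t : ℝ) : MetricGraph G d :=
  SeparationQuotient.mk (Piece.onEdge e (Set.projIcc 0 (d.len e) (d.pos e).le t)
    (Set.projIcc 0 (d.len e) (d.pos e).le t).2.1 (Set.projIcc 0 (d.len e) (d.pos e).le t).2.2)

theorem lipschitzWith_edgeMap (e : E) : LipschitzWith 1 (edgeMap d e) := by
  refine LipschitzWith.of_dist_le_mul fun s t => ?_
  rw [NNReal.coe_one, one_mul]
  refine (dist_le_of_pathCost (.segment e _ _ _ _ _ _)).trans ?_
  have := (LipschitzWith.projIcc (d.pos e).le).dist_le_mul s t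
  rwa [NNReal.coe_one, one_mul] at this

theorem edgeMap_eq_mk {e : E} {t : ℝ} (h₀ : 0 ≤ t) (h₁ : t ≤ d.len e) :
    edgeMap d e t = SeparationQuotient.mk (Piece.onEdge e t h₀ h₁) := by
  unfold edgeMap
  simp [Set.projIcc_of_mem (d.pos e).le ⟨h₀, h₁⟩]

theorem edgeMap_zero (e : E) : edgeMap d e 0 = MetricGraph.vertex G d (G.src e) := by
  rw [edgeMap_eq_mk le_rfl (d.pos e).le]
  refine SeparationQuotient.mk_eq_mk.2 (Metric.inseparable_iff.2 (le_antisymm ?_ dist_nonneg))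
  exact dist_le_of_pathCost (.origin e (d.pos e).le)

theorem edgeMap_len (e : E) : edgeMap d e (d.len e) = MetricGraph.vertex G d (G.tgt e) := by
  rw [edgeMap_eq_mk (d.pos e).le le_rfl]
  refine SeparationQuotient.mk_eq_mk.2 (Metric.inseparable_iff.2 (le_antisymm ?_ dist_nonneg))
  have := dist_le_of_pathCost ((PathCost.flip (G := G) (d := d) e (d.len e) 0 (d.pos e).le le_rfl
    le_rfl (d.pos _).le (add_zero _)).trans (.origin (G.rev e) (d.pos _).le))
  rwa [add_zero] at this

theorem dist_vertex_edgeMap_le (e : E) {t : ℝ} (h₀ : 0 ≤ t) :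
    dist (MetricGraph.vertex G d (G.src e)) (edgeMap d e t) ≤ t := by
  rw [← edgeMap_zero]
  have := (lipschitzWith_edgeMap (d := d) e).dist_le_mul 0 t
  rwa [NNReal.coe_one, one_mul, Real.dist_eq, zero_sub, abs_neg, abs_of_nonneg h₀] at this

theorem dist_vertex_vertex_le (e : E) :
    dist (MetricGraph.vertex G d (G.src e)) (MetricGraph.vertex G d (G.tgt e)) ≤ d.len e := by
  rw [← edgeMap_len]
  exact dist_vertex_edgeMap_le e (d.pos e).le

theorem eq_vertex_or_exists_edgeMap_eq (x : MetricGraph G d) :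
    (∃ v, x = MetricGraph.vertex G d v) ∨ ∃ e, ∃ t ∈ Set.Icc 0 (d.len e), x = edgeMap d e t := by
  obtain ⟨p, rfl⟩ := SeparationQuotient.surjective_mk x
  cases p with
  | vertex v => exact .inl ⟨v, rfl⟩
  | onEdge e t h₀ h₁ => exact .inr ⟨e, t, ⟨h₀, h₁⟩, (edgeMap_eq_mk h₀ h₁).symm⟩

theorem exists_vertex_dist_le {b : ℝ} (hb₀ : 0 ≤ b) (hb : ∀ e, d.len e ≤ b)
    (x : MetricGraph G d) : ∃ v, dist (MetricGraph.vertex G d v) x ≤ b := by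
  obtain ⟨v, rfl⟩ | ⟨e, t, ht, rfl⟩ := eq_vertex_or_exists_edgeMap_eq x
  · exact ⟨v, by rwa [dist_self]⟩
  · exact ⟨G.src e, (dist_vertex_edgeMap_le e ht.1).trans (ht.2.trans (hb e))⟩

/-! ### Hausdorff measure of edges -/

open Classical in
/-- The distance to the boundary of the edge `p` inside this edge, and zero outside of it. -/
noncomputable def edgeBump (d : G.Lengths) (p : E) : Piece G d → ℝ
  | .vertex _ => 0
  | .onEdge e t _ _ => if e = p ∨ e = G.rev p then min t (d.len e - t) else 0

open Classical in
theorem abs_edgeBump_sub_le (p : E) (x y : Piece G d) :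
    |edgeBump d p x - edgeBump d p y| ≤ dist x y := by
  refine abs_sub_le_dist ?_ ?_ ?_ x y
  · intro e s t _ _ _ _
    simp only [edgeBump]
    split_ifs
    · refine (abs_min_sub_min_le_max _ _ _ _).trans (max_le le_rfl ?_)
      rw [sub_sub_sub_cancel_left, abs_sub_comm]
    · simp
  · intro e s t _ _ _ _ hst
    have h : (G.rev e = p ∨ G.rev e = G.rev p) ↔ (e = p ∨ e = G.rev p) := by
      rw [G.rev_injective.eq_iff, or_comm]
      refine or_congr_right ⟨?_, ?_⟩
      · rintro rfl
        exact (G.rev_rev e).symm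
      · rintro rfl
        exact G.rev_rev p
    simp only [edgeBump, d.len_rev]
    rw [← hst, add_sub_cancel_left, add_sub_cancel_right, min_comm]
    rw [if_congr h.symm rfl rfl]
  · intro e h
    simp [edgeBump, h]

/-- The function `edgeBump` on the metric graph. -/
noncomputable def bump (d : G.Lengths) (p : E) : MetricGraph G d → ℝ :=
  SeparationQuotient.lift (edgeBump d p) fun x y hxy => by
    have := abs_edgeBump_sub_le p x y
    rw [Metric.inseparable_iff.1 hxy] at this
    exact sub_eq_zero.1 (abs_nonpos_iff.1 this)

theorem bump_mk (p : E) (x : Piece G d) : bump d p (SeparationQuotient.mk x) = edgeBump d p x :=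
  rfl

theorem lipschitzWith_bump (p : E) : LipschitzWith 1 (bump d p) := by
  refine LipschitzWith.of_dist_le_mul fun x y => ?_
  obtain ⟨x, rfl⟩ := SeparationQuotient.surjective_mk x
  obtain ⟨y, rfl⟩ := SeparationQuotient.surjective_mk y
  rw [NNReal.coe_one, one_mul]
  exact abs_edgeBump_sub_le p x y

/-- A closed segment in the interior of an edge. -/
def innerSegment (d : G.Lengths) (p : E) : Set (MetricGraph G d) :=
  edgeMap d p '' Set.Icc (d.len p / 3) (d.len p / 2)

theorem bump_edgeMap (p : E) {t : ℝ} (ht : t ∈ Set.Icc (d.len p / 3) (d.len p / 2)) :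
    bump d p (edgeMap d p t) = t := by
  have hp := d.pos p
  rw [edgeMap_eq_mk (by linarith [ht.1]) (by linarith [ht.2]), bump_mk]
  simp only [edgeBump, true_or, if_true]
  exact min_eq_left (by linarith [ht.2])

/-- The bump of `q` is positive on the inner segment of `q` and vanishes on every edge other than
`q` and its reverse. -/
theorem disjoint_innerSegment {p q : E} (hpq : p ≠ q) (hpq' : p ≠ G.rev q) :
    Disjoint (innerSegment d p) (innerSegment d q) := by
  rw [Set.disjoint_left]
  rintro _ ⟨s, hs, rfl⟩ ⟨t, ht, hst⟩
  have h₁ := bump_edgeMap q ht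
  have hp := d.pos p
  rw [hst, edgeMap_eq_mk (by linarith [hs.1]) (by linarith [hs.2]), bump_mk] at h₁
  simp only [edgeBump, hpq, hpq', or_self, if_false] at h₁
  linarith [d.pos q, ht.1]

theorem isCompact_innerSegment (p : E) : IsCompact (innerSegment d p) :=
  isCompact_Icc.image (lipschitzWith_edgeMap p).continuous

variable [MeasurableSpace (MetricGraph G d)] [BorelSpace (MetricGraph G d)]

theorem hausdorffMeasure_image_edgeMap_le (e : E) :
    μH[1] (edgeMap d e '' Set.Icc 0 (d.len e)) ≤ ENNReal.ofReal (d.len e) := by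
  have := ((lipschitzWith_edgeMap (d := d) e).lipschitzOnWith
    (s := Set.Icc 0 (d.len e))).hausdorffMeasure_image_le zero_le_one
  simpa [hausdorffMeasure_real] using this

/-- On the first half of the edge the bump is the arc length parameter, so a `1`-Lipschitz function
maps the segment onto an interval of length `d.len p / 6`. -/
theorem le_hausdorffMeasure_innerSegment (p : E) :
    ENNReal.ofReal (d.len p / 6) ≤ μH[1] (innerSegment d p) := by
  have h := ((lipschitzWith_bump (d := d) p).lipschitzOnWith
    (s := innerSegment d p)).hausdorffMeasure_image_le zero_le_one
  have h₁ : bump d p '' innerSegment d p = Set.Icc (d.len p / 3) (d.len p / 2) := by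
    rw [innerSegment, Set.image_image, Set.image_congr fun t ht => bump_edgeMap p ht,
      Set.image_id']
  rw [h₁, hausdorffMeasure_real, Real.volume_Icc] at h
  simpa [show d.len p / 2 - d.len p / 3 = d.len p / 6 by ring] using h

end

/-! ### Metric trees -/

/-- A vertex of the universal cover, as a point of the metric tree. -/
noncomputable def MetricTree.vertex {G : SerreGraph V E} (d : G.Lengths) (v₀ : V)
    (w : G.CoverVertex v₀) : MetricTree G d v₀ :=
  MetricGraph.vertex (G.universalCover v₀) (d.lift v₀) w

theorem abs_pathLength_appendEdge_sub {G : SerreGraph V E} (d : G.Lengths) (w : List E) (e : E) :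
    |pathLength d (G.appendEdge w e) - pathLength d w| ≤ d.len e := by
  unfold appendEdge
  split_ifs with h
  · cases w with
    | nil => simp at h
    | cons f w =>
      obtain rfl : f = G.rev e := by simpa using h
      rw [List.tail_cons, pathLength_cons, d.len_rev, sub_add_cancel_right, abs_neg,
        abs_of_pos (d.pos e)]
  · rw [pathLength_cons, add_sub_cancel_right, abs_of_pos (d.pos e)]

/-- The upper bound follows the reduced path edge by edge. The lower bound holds because appending
or cancelling an edge changes the path length by the length of that edge. -/
theorem dist_root_vertex {G : SerreGraph V E} (d : G.Lengths) (v₀ : V) (w : G.CoverVertex v₀) :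
    dist (MetricTree.root G d v₀) (MetricTree.vertex d v₀ w) = pathLength d w.1 := by
  refine le_antisymm ?_ ?_
  · obtain ⟨w, hw⟩ := w
    induction w with
    | nil => exact (dist_self (MetricTree.root G d v₀)).le.trans_eq rfl
    | cons e w ih =>
      have h : (G.universalCover v₀).tgt ⟨(⟨w, hw.2.2⟩, e), hw.1⟩ = ⟨e :: w, hw⟩ :=
        Subtype.ext (if_neg hw.2.1)
      have h₁ := dist_vertex_vertex_le (d := d.lift v₀)
        (⟨(⟨w, hw.2.2⟩, e), hw.1⟩ : G.CoverEdge v₀)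
      rw [h] at h₁
      rw [pathLength_cons, add_comm]
      exact (dist_triangle _ _ _).trans (add_le_add (ih hw.2.2) h₁)
  · have := abs_sub_le_dist_vertex (d := d.lift v₀)
      (ψ := fun w : G.CoverVertex v₀ => pathLength d w.1)
      (fun p => abs_pathLength_appendEdge_sub d p.1.1.1 p.1.2) w (G.coverRoot v₀)
    rw [dist_comm]
    refine le_trans ?_ this
    change _ ≤ |pathLength d w.1 - 0|
    rw [sub_zero]
    exact le_abs_self _

theorem exists_foldl_appendEdge {G : SerreGraph V E} (v₀ : V) (u v : G.CoverVertex v₀) :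
    ∃ es : List E, es.foldl G.appendEdge u.1 = v.1 := by
  have h := Connected.joined (G := G.universalCover v₀) u v
  induction h with
  | refl => exact ⟨[], rfl⟩
  | tail _ h ih =>
    obtain ⟨p, rfl, rfl⟩ := h
    obtain ⟨es, hes⟩ := ih
    refine ⟨es ++ [p.1.2], ?_⟩
    rw [List.foldl_append, hes]
    rfl

/-- The least number of edges of a path that joins two vertices of the universal cover. -/
noncomputable def edgeDist (G : SerreGraph V E) (v₀ : V) (u v : G.CoverVertex v₀) : ℕ :=
  sInf {n | ∃ es : List E, es.length = n ∧ es.foldl G.appendEdge u.1 = v.1}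

theorem exists_length_eq_edgeDist {G : SerreGraph V E} (v₀ : V) (u v : G.CoverVertex v₀) :
    ∃ es : List E, es.length = G.edgeDist v₀ u v ∧ es.foldl G.appendEdge u.1 = v.1 := by
  obtain ⟨es, hes⟩ := exists_foldl_appendEdge v₀ u v
  exact Nat.sInf_mem (s := {n | ∃ es : List E, es.length = n ∧ es.foldl G.appendEdge u.1 = v.1})
    ⟨_, es, rfl, hes⟩

theorem edgeDist_tgt_le {G : SerreGraph V E} (v₀ : V) (u : G.CoverVertex v₀)
    (p : G.CoverEdge v₀) : G.edgeDist v₀ u ((G.universalCover v₀).tgt p) ≤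
      G.edgeDist v₀ u ((G.universalCover v₀).src p) + 1 := by
  obtain ⟨es, hes, hes'⟩ := exists_length_eq_edgeDist v₀ u ((G.universalCover v₀).src p)
  refine Nat.sInf_le ⟨es ++ [p.1.2], by rw [List.length_append, hes]; rfl, ?_⟩
  rw [List.foldl_append, hes']
  rfl

theorem edgeDist_src_le {G : SerreGraph V E} (v₀ : V) (u : G.CoverVertex v₀)
    (p : G.CoverEdge v₀) : G.edgeDist v₀ u ((G.universalCover v₀).src p) ≤
      G.edgeDist v₀ u ((G.universalCover v₀).tgt p) + 1 := by
  have := edgeDist_tgt_le v₀ u ((G.universalCover v₀).rev p)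
  rwa [tgt_rev] at this

theorem edgeDist_self {G : SerreGraph V E} (v₀ : V) (u : G.CoverVertex v₀) :
    G.edgeDist v₀ u u = 0 :=
  Nat.eq_zero_of_le_zero (Nat.sInf_le ⟨[], rfl, rfl⟩)

theorem edgeDist_mul_le_dist {G : SerreGraph V E} (d : G.Lengths) (v₀ : V) {a : ℝ} (ha₀ : 0 ≤ a)
    (ha : ∀ e, a ≤ d.len e) (u v : G.CoverVertex v₀) :
    G.edgeDist v₀ u v * a ≤ dist (MetricTree.vertex d v₀ u) (MetricTree.vertex d v₀ v) := by
  have := abs_sub_le_dist_vertex (d := d.lift v₀)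
    (ψ := fun v : G.CoverVertex v₀ => (G.edgeDist v₀ u v : ℝ) * a)
    (fun p => by
      have h₁ : (G.edgeDist v₀ u ((G.universalCover v₀).tgt p) : ℝ) ≤
        G.edgeDist v₀ u ((G.universalCover v₀).src p) + 1 := by
          exact_mod_cast edgeDist_tgt_le v₀ u p
      have h₂ : (G.edgeDist v₀ u ((G.universalCover v₀).src p) : ℝ) ≤
        G.edgeDist v₀ u ((G.universalCover v₀).tgt p) + 1 := by
          exact_mod_cast edgeDist_src_le v₀ u p
      rw [← sub_mul, abs_mul, abs_of_nonneg ha₀]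
      refine (mul_le_of_le_one_left ha₀ (abs_le.2 ⟨by linarith, by linarith⟩)).trans
        (ha p.1.2)) v u
  simp only [edgeDist_self, Nat.cast_zero, zero_mul, sub_zero] at this
  rw [dist_comm]
  exact (le_abs_self _).trans this

/-- The number of vertices in a ball about a vertex of the tree is bounded in terms of the
radius. -/
theorem exists_card_le_of_dist_le [Finite E] {G : SerreGraph V E} (d : G.Lengths) (v₀ : V)
    (D : ℝ) : ∃ M : ℕ, ∀ (u : G.CoverVertex v₀) (s : Finset (G.CoverVertex v₀)),
      (∀ v ∈ s, dist (MetricTree.vertex d v₀ u) (MetricTree.vertex d v₀ v) ≤ D) → s.card ≤ M := by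
  classical
  obtain ⟨a, ha, hla⟩ := exists_len_lower_bound d
  -- A vertex within `D` of `u` is obtained by appending to `u` at most `D / a` edges, and the
  -- number of such edge lists does not depend on `u`.
  set L := (List.finite_length_le E ⌊D / a⌋₊).toFinset with hL
  refine ⟨L.card, fun u s hs => ?_⟩
  have hsub : s.image Subtype.val ⊆ L.image fun es => es.foldl G.appendEdge u.1 := by
    intro w hw
    obtain ⟨v, hv, rfl⟩ := Finset.mem_image.1 hw
    obtain ⟨es, hes, hes'⟩ := exists_length_eq_edgeDist v₀ u v
    refine Finset.mem_image.2 ⟨es, ?_, hes'⟩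
    simp only [hL, Set.Finite.mem_toFinset, Set.mem_ofPred_eq]
    refine Nat.le_floor ?_
    rw [le_div_iff₀ ha, hes]
    exact (edgeDist_mul_le_dist d v₀ ha.le hla u v).trans (hs v hv)
  calc s.card = (s.image Subtype.val).card :=
        (Finset.card_image_of_injective _ Subtype.val_injective).symm
    _ ≤ _ := Finset.card_le_card hsub
    _ ≤ _ := Finset.card_image_le

/-- The vertices of the tree at distance at most `r` from the base point. -/
noncomputable def shortVertices [Finite E] {G : SerreGraph V E} (d : G.Lengths) (v₀ : V) (r : ℝ) :
    Finset (G.CoverVertex v₀) :=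
  open Classical in (shortPaths d v₀ r).subtype fun w => G.IsReducedPath v₀ w

theorem mem_shortVertices [Finite E] {G : SerreGraph V E} {d : G.Lengths} {v₀ : V} {r : ℝ}
    {w : G.CoverVertex v₀} : w ∈ shortVertices d v₀ r ↔ pathLength d w.1 ≤ r := by
  classical
  exact Finset.mem_subtype.trans (mem_shortPaths.trans (and_iff_right w.2))

theorem card_shortVertices [Finite E] {G : SerreGraph V E} (d : G.Lengths) (v₀ : V) (r : ℝ) :
    (shortVertices d v₀ r).card = (shortPaths d v₀ r).card := by
  classical
  refine (Finset.card_subtype _ _).trans ?_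
  rw [Finset.filter_true_of_mem fun w hw => (mem_shortPaths.1 hw).1]

/-! ### Volume of balls -/

section

variable [Fintype E] {G : SerreGraph V E} (d : G.Lengths) (v₀ : V)
  [MeasurableSpace (MetricTree G d v₀)] [BorelSpace (MetricTree G d v₀)]

/-- A ball is covered by edges of length at most `b` whose origins lie within `r + b` of the root,
with at most `|E|` edges for each origin. -/
theorem exists_hausdorffMeasure_ball_le (hdeg : ∀ v, 3 ≤ G.degree v) :
    ∃ C > 0, ∃ b, ∀ r, μH[1] (Metric.ball (MetricTree.root G d v₀) r) ≤
      ENNReal.ofReal (C * (shortPaths d v₀ (r + b)).card) := by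
  classical
  have hE : 0 < Fintype.card E := by
    obtain ⟨e, -⟩ := Finset.card_pos.1
      (lt_of_lt_of_le two_pos (two_le_card_extensions hdeg v₀ []))
    exact Fintype.card_pos_iff.2 ⟨e⟩
  obtain ⟨b, hb₀, hb⟩ := exists_len_upper_bound d
  refine ⟨Fintype.card E * b, mul_pos (by exact_mod_cast hE) hb₀, b, fun r => ?_⟩
  set S : Finset (G.CoverEdge v₀) :=
    ((shortVertices d v₀ (r + b)) ×ˢ (Finset.univ : Finset E)).subtype
      (fun p => G.src p.2 = G.endpoint v₀ p.1.1) with hS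
  have hmem : ∀ p : G.CoverEdge v₀, p ∈ S ↔ pathLength d p.1.1.1 ≤ r + b := by
    intro p
    refine Finset.mem_subtype.trans ?_
    simp [mem_shortVertices]
  have hcard : S.card ≤ (shortPaths d v₀ (r + b)).card * Fintype.card E := by
    refine (Finset.card_subtype _ _).le.trans ((Finset.card_filter_le _ _).trans ?_)
    rw [Finset.card_product, card_shortVertices, Finset.card_univ]
  have hcover : Metric.ball (MetricTree.root G d v₀) r ⊆
      ⋃ p ∈ S, edgeMap (d.lift v₀) p '' Set.Icc 0 ((d.lift v₀).len p) := by
    intro x hx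
    obtain ⟨p, t, ht, rfl⟩ : ∃ p, ∃ t ∈ Set.Icc 0 ((d.lift v₀).len p),
        x = edgeMap (d.lift v₀) p t := by
      obtain ⟨w, rfl⟩ | h := eq_vertex_or_exists_edgeMap_eq x
      · obtain ⟨e, he⟩ := Finset.card_pos.1
          (lt_of_lt_of_le two_pos (two_le_card_extensions hdeg v₀ w.1))
        exact ⟨⟨(w, e), (mem_extensions.1 he).1⟩, 0, ⟨le_rfl, ((d.lift v₀).pos _).le⟩,
          (edgeMap_zero (d := d.lift v₀) (⟨(w, e), (mem_extensions.1 he).1⟩ :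
            G.CoverEdge v₀)).symm⟩
      · exact h
    refine Set.mem_iUnion₂.2 ⟨p, (hmem p).2 ?_, t, ht, rfl⟩
    have h₁ := dist_vertex_edgeMap_le (d := d.lift v₀) p ht.1
    have h₂ := dist_triangle (MetricTree.root G d v₀) (edgeMap (d.lift v₀) p t)
      (MetricTree.vertex d v₀ p.1.1)
    rw [dist_root_vertex] at h₂
    rw [Metric.mem_ball, dist_comm] at hx
    rw [dist_comm] at h₁
    have h₃ : dist (edgeMap (d.lift v₀) p t) (MetricTree.vertex d v₀ p.1.1) ≤ t := h₁
    have h₄ : t ≤ b := ht.2.trans (hb p.1.2)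
    linarith
  calc μH[1] (Metric.ball (MetricTree.root G d v₀) r)
      ≤ ∑ p ∈ S, μH[1] (edgeMap (d.lift v₀) p '' Set.Icc 0 ((d.lift v₀).len p)) :=
        (measure_mono hcover).trans (measure_biUnion_finset_le _ _)
    _ ≤ ∑ p ∈ S, ENNReal.ofReal b := Finset.sum_le_sum fun p _ =>
        (hausdorffMeasure_image_edgeMap_le p).trans (ENNReal.ofReal_le_ofReal (hb p.1.2))
    _ = ENNReal.ofReal (S.card * b) := by
        rw [Finset.sum_const, nsmul_eq_mul, ENNReal.ofReal_mul (Nat.cast_nonneg _),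
          ENNReal.ofReal_natCast]
    _ ≤ _ := by
        refine ENNReal.ofReal_le_ofReal ?_
        have : (S.card : ℝ) ≤ (shortPaths d v₀ (r + b)).card * Fintype.card E := by
          exact_mod_cast hcard
        nlinarith

/-- Each vertex within `r - b` is given one edge leading away from the root. No two of these edges
agree up to orientation, so their inner segments are disjoint, each of length at least `a / 6`. -/
theorem exists_le_hausdorffMeasure_ball (hdeg : ∀ v, 3 ≤ G.degree v) :
    ∃ c > 0, ∃ b, ∀ r, ENNReal.ofReal (c * (shortPaths d v₀ (r - b)).card) ≤
      μH[1] (Metric.ball (MetricTree.root G d v₀) r) := by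
  obtain ⟨a, ha₀, ha⟩ := exists_len_lower_bound d
  obtain ⟨b, hb₀, hb⟩ := exists_len_upper_bound d
  have hext : ∀ w : G.CoverVertex v₀, ∃ e, e ∈ G.extensions v₀ w.1 := fun w =>
    Finset.card_pos.1 (lt_of_lt_of_le two_pos (two_le_card_extensions hdeg v₀ w.1))
  choose f hf using hext
  set p : G.CoverVertex v₀ → G.CoverEdge v₀ :=
    fun w => ⟨(w, f w), (mem_extensions.1 (hf w)).1⟩ with hp
  -- Otherwise `u` would be `w` extended by `f w`, and `f u` would backtrack along that last edge.
  have hrev : ∀ u w, p u ≠ (G.universalCover v₀).rev (p w) := by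
    intro u w h
    have h₁ : u.1 = G.appendEdge w.1 (f w) := congrArg (fun q => q.1.1.1) h
    have h₂ : f u = G.rev (f w) := congrArg (fun q => q.1.2) h
    refine (mem_extensions.1 (hf u)).2 ?_
    rw [h₁, appendEdge, if_neg (mem_extensions.1 (hf w)).2, h₂, G.rev_rev]
    rfl
  refine ⟨a / 6, by positivity, b, fun r => ?_⟩
  have hdisj : Set.PairwiseDisjoint (shortVertices d v₀ (r - b) : Set (G.CoverVertex v₀))
      fun w => innerSegment (d.lift v₀) (p w) := by
    intro u _ w _ huw
    exact disjoint_innerSegment (fun h => huw (congrArg (fun q => q.1.1) h)) (hrev u w)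
  have hsub : (⋃ w ∈ shortVertices d v₀ (r - b), innerSegment (d.lift v₀) (p w)) ⊆
      Metric.ball (MetricTree.root G d v₀) r := by
    refine Set.iUnion₂_subset fun w hw => ?_
    rintro _ ⟨t, ht, rfl⟩
    have hpos := (d.lift v₀).pos (p w)
    have h₁ := dist_vertex_edgeMap_le (d := d.lift v₀) (p w) (t := t) (by linarith [ht.1])
    have h₂ : dist (MetricTree.vertex d v₀ w) (edgeMap (d.lift v₀) (p w) t) ≤ t := h₁
    have h₃ := dist_triangle (MetricTree.root G d v₀) (MetricTree.vertex d v₀ w)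
      (edgeMap (d.lift v₀) (p w) t)
    rw [dist_root_vertex] at h₃
    have h₄ := mem_shortVertices.1 hw
    have h₅ : (d.lift v₀).len (p w) ≤ b := hb _
    rw [Metric.mem_ball, dist_comm]
    linarith [ht.2]
  calc ENNReal.ofReal (a / 6 * (shortPaths d v₀ (r - b)).card)
      = ∑ w ∈ shortVertices d v₀ (r - b), ENNReal.ofReal (a / 6) := by
        rw [Finset.sum_const, nsmul_eq_mul, card_shortVertices, mul_comm,
          ENNReal.ofReal_mul (Nat.cast_nonneg _), ENNReal.ofReal_natCast]
    _ ≤ ∑ w ∈ shortVertices d v₀ (r - b), μH[1] (innerSegment (d.lift v₀) (p w)) :=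
        Finset.sum_le_sum fun w _ => (ENNReal.ofReal_le_ofReal (by
          have : a ≤ (d.lift v₀).len (p w) := ha _
          linarith)).trans (le_hausdorffMeasure_innerSegment (p w))
    _ = μH[1] (⋃ w ∈ shortVertices d v₀ (r - b), innerSegment (d.lift v₀) (p w)) :=
        (measure_biUnion_finset hdisj fun w _ =>
          (isCompact_innerSegment (p w)).isClosed.measurableSet).symm
    _ ≤ _ := measure_mono hsub

end

end SerreGraph

/-! ### Volume entropy -/

theorem tendsto_log_const_mul_exp_div {c : ℝ} (hc : 0 < c) (h : ℝ) :
    Tendsto (fun r : ℝ => ENNReal.log (ENNReal.ofReal (c * Real.exp (h * r))) / (r : EReal)) atTop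
      (nhds (h : EReal)) := by
  have h₁ : Tendsto (fun r : ℝ => Real.log c / r + h) atTop (nhds (0 + h)) :=
    (tendsto_const_nhds.div_atTop tendsto_id).add_const h
  rw [zero_add] at h₁
  refine ((continuous_coe_real_ereal.tendsto h).comp h₁).congr' ?_
  filter_upwards [eventually_gt_atTop 0] with r hr
  rw [ENNReal.log_ofReal_of_pos (mul_pos hc (Real.exp_pos _)), ← EReal.coe_div,
    Real.log_mul hc.ne' (Real.exp_pos _).ne', Real.log_exp, Function.comp_apply, add_div,
    mul_div_cancel_right₀ _ hr.ne']

theorem tendsto_log_div_of_exp_bounds {f : ℝ → ENNReal} {c C h : ℝ} (hc : 0 < c) (hC : 0 < C)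
    (hl : ∀ᶠ r in atTop, ENNReal.ofReal (c * Real.exp (h * r)) ≤ f r)
    (hu : ∀ᶠ r in atTop, f r ≤ ENNReal.ofReal (C * Real.exp (h * r))) :
    Tendsto (fun r : ℝ => ENNReal.log (f r) / (r : EReal)) atTop (nhds (h : EReal)) := by
  refine tendsto_of_tendsto_of_tendsto_of_le_of_le' (tendsto_log_const_mul_exp_div hc h)
    (tendsto_log_const_mul_exp_div hC h) ?_ ?_
  · filter_upwards [hl, eventually_ge_atTop 0] with r hr hr₀
    exact EReal.div_le_div_right_of_nonneg (EReal.coe_nonneg.2 hr₀) (ENNReal.log_monotone hr)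
  · filter_upwards [hu, eventually_ge_atTop 0] with r hr hr₀
    exact EReal.div_le_div_right_of_nonneg (EReal.coe_nonneg.2 hr₀) (ENNReal.log_monotone hr)

namespace SerreGraph

variable {V E : Type*}

section

variable [Fintype E] {G : SerreGraph V E} {d : G.Lengths} {h : ℝ} {x : E → ℝ}

/-- The volume growth rate exists and is the parameter for which the transfer operator has a
positive fixed vector. -/
theorem tendsto_logVolumeRate (hdeg : ∀ v, 3 ≤ G.degree v) (v₀ : V) (hh : 0 ≤ h)
    (hx : ∀ e, 0 < x e) (heig : ∀ e, G.transfer d h x e = x e) :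
    Tendsto (logVolumeRate 1 (MetricTree.root G d v₀)) atTop (nhds (h : EReal)) := by
  let _ : MeasurableSpace (MetricTree G d v₀) := borel (MetricTree G d v₀)
  have : BorelSpace (MetricTree G d v₀) := ⟨rfl⟩
  change Tendsto (fun r : ℝ => ENNReal.log (μH[1] (Metric.ball (MetricTree.root G d v₀) r)) /
    (r : EReal)) atTop _
  obtain ⟨C, hC, b, hCb⟩ := exists_hausdorffMeasure_ball_le d v₀ hdeg
  obtain ⟨c, hc, b', hcb⟩ := exists_le_hausdorffMeasure_ball d v₀ hdeg
  obtain ⟨C', hC', hN⟩ := exists_card_shortPaths_le (v₀ := v₀) hdeg hh hx heig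
  obtain ⟨c', hc', hN'⟩ := exists_le_card_shortPaths (v₀ := v₀) hdeg hh hx heig
  -- Shifts of the radius by `b` and `b'` only multiply the exponential by constants.
  refine tendsto_log_div_of_exp_bounds (c := c * (c' * Real.exp (-(h * b'))))
    (C := C * (C' * Real.exp (h * b))) (by positivity) (by positivity) ?_ ?_
  · have := (tendsto_atTop_add_const_right atTop (-b') tendsto_id).eventually hN'
    filter_upwards [this] with r hr
    refine le_trans (ENNReal.ofReal_le_ofReal ?_) (hcb r)
    rw [mul_assoc]
    refine mul_le_mul_of_nonneg_left (le_trans (le_of_eq ?_) hr) hc.le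
    rw [mul_assoc, ← Real.exp_add]
    congr 2
    simp only [id]
    ring
  · filter_upwards [eventually_ge_atTop (-b)] with r hr
    refine (hCb r).trans (ENNReal.ofReal_le_ofReal ?_)
    rw [mul_assoc]
    refine mul_le_mul_of_nonneg_left ((hN (r + b) (by linarith)).trans (le_of_eq ?_)) hC.le
    rw [mul_assoc, ← Real.exp_add]
    congr 2
    ring

theorem volumeEntropy_eq (hdeg : ∀ v, 3 ≤ G.degree v) (v₀ : V) (hh : 0 ≤ h)
    (hx : ∀ e, 0 < x e) (heig : ∀ e, G.transfer d h x e = x e) :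
    G.volumeEntropy v₀ d = h :=
  (tendsto_logVolumeRate hdeg v₀ hh hx heig).limsup_eq

theorem volumeEntropy_limLengths [Nonempty E] (hdeg : ∀ v, 3 ≤ G.degree v) (v₀ : V) :
    G.volumeEntropy v₀ (G.limLengths hdeg) = G.walkEntropy :=
  volumeEntropy_eq hdeg v₀ (walkEntropy_pos hdeg).le
    (fun e => Real.sqrt_pos.2 (by linarith [two_le_branching hdeg (G.tgt e)]))
    (transfer_limLengths G hdeg)

end

/-! ### Almost-isometries preserve the growth rate -/

/-- Coarse surjectivity sends each vertex `w` of the second tree to a vertex `v w` near a coarse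
preimage `x w`. The lower distance bound controls how far `v w` is from the root, and the upper
bound controls the fibers of `v`. -/
theorem exists_card_shortPaths_le_of_almostIsometric [Finite E] {G : SerreGraph V E}
    {d₀ d₁ : G.Lengths} {v₀ : V} (h : AlmostIsometric (MetricTree G d₀ v₀) (MetricTree G d₁ v₀)) :
    ∃ (M : ℕ) (c : ℝ), 0 ≤ c ∧ ∀ r,
      (shortPaths d₁ v₀ r).card ≤ M * (shortPaths d₀ v₀ (r + c)).card := by
  classical
  obtain ⟨C, hC, φ, hφ, hsurj⟩ := h
  obtain ⟨b, hb₀, hb⟩ := exists_len_upper_bound d₀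
  choose x hx using fun w : G.CoverVertex v₀ => hsurj (MetricTree.vertex d₁ v₀ w)
  have hnear : ∀ y : MetricTree G d₀ v₀, ∃ w, dist (MetricTree.vertex d₀ v₀ w) y ≤ b :=
    exists_vertex_dist_le hb₀.le fun p => hb p.1.2
  choose v hv using fun w => hnear (x w)
  -- If `v w = v w'`, then `x w` and `x w'` are within `2 * b`, their images within `2 * b + C`, and
  -- `w`, `w'` within `2 * b + 3 * C`.
  obtain ⟨M, hM⟩ := exists_card_le_of_dist_le d₁ v₀ (2 * b + 3 * C)
  set D := dist (MetricTree.root G d₁ v₀) (φ (MetricTree.root G d₀ v₀)) with hD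
  have hlow : ∀ y z, dist y z ≤ dist (φ y) (φ z) + C := fun y z => by
    have := (hφ y z).1
    linarith
  have hup : ∀ y z, dist (φ y) (φ z) ≤ dist y z + C := fun y z => by
    have := (hφ y z).2
    linarith
  -- The shift collects `b` from `v w` to `x w`, one `C` from the lower distance bound, another from
  -- `φ (x w)` to `w`, and `D` from the displacement of the root.
  refine ⟨M, b + 2 * C + D, by positivity, fun r => ?_⟩
  rw [← card_shortVertices, ← card_shortVertices]
  refine (Finset.card_le_mul_card_image_of_maps_to (f := v) (fun w hw => ?_) M fun u _ => ?_)
  · rw [mem_shortVertices] at hw ⊢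
    rw [← dist_root_vertex] at hw ⊢
    have h₁ := dist_triangle (MetricTree.root G d₀ v₀) (x w) (MetricTree.vertex d₀ v₀ (v w))
    have h₂ := hlow (MetricTree.root G d₀ v₀) (x w)
    have h₃ := dist_triangle4 (φ (MetricTree.root G d₀ v₀)) (MetricTree.root G d₁ v₀)
      (MetricTree.vertex d₁ v₀ w) (φ (x w))
    have h₄ := hx w
    have h₅ := hv w
    rw [dist_comm] at h₄ h₅
    rw [dist_comm (φ (MetricTree.root G d₀ v₀)) (MetricTree.root G d₁ v₀), ← hD] at h₃
    linarith
  · obtain hempty | ⟨w₀, hw₀⟩ :=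
      ((shortVertices d₁ v₀ r).filter fun w => v w = u).eq_empty_or_nonempty
    · rw [hempty, Finset.card_empty]
      exact Nat.zero_le _
    · refine hM w₀ _ fun w hw => ?_
      rw [Finset.mem_filter] at hw hw₀
      have h₁ := dist_triangle_left (x w₀) (x w) (MetricTree.vertex d₀ v₀ u)
      have h₂ := hv w₀
      have h₃ := hv w
      rw [hw₀.2] at h₂
      rw [hw.2] at h₃
      have h₄ := hup (x w₀) (x w)
      have h₅ := dist_triangle4 (MetricTree.vertex d₁ v₀ w₀) (φ (x w₀)) (φ (x w))
        (MetricTree.vertex d₁ v₀ w)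
      have h₆ := hx w₀
      have h₇ := hx w
      rw [dist_comm] at h₆
      linarith

theorem le_of_almostIsometric [Fintype E] {G : SerreGraph V E} (hdeg : ∀ v, 3 ≤ G.degree v)
    {d₀ d₁ : G.Lengths} {v₀ : V} {h₀ h₁ : ℝ} {x₀ x₁ : E → ℝ} (hh₀ : 0 ≤ h₀) (hh₁ : 0 ≤ h₁)
    (hx₀ : ∀ e, 0 < x₀ e) (hx₁ : ∀ e, 0 < x₁ e) (heig₀ : ∀ e, G.transfer d₀ h₀ x₀ e = x₀ e)
    (heig₁ : ∀ e, G.transfer d₁ h₁ x₁ e = x₁ e)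
    (h : AlmostIsometric (MetricTree G d₀ v₀) (MetricTree G d₁ v₀)) : h₁ ≤ h₀ := by
  obtain ⟨M, a, ha, hMa⟩ := exists_card_shortPaths_le_of_almostIsometric h
  obtain ⟨C, hC, hN₀⟩ := exists_card_shortPaths_le (v₀ := v₀) hdeg hh₀ hx₀ heig₀
  obtain ⟨c, hc, hN₁⟩ := exists_le_card_shortPaths (v₀ := v₀) hdeg hh₁ hx₁ heig₁
  by_contra! hlt
  have hbound : ∀ᶠ r in atTop,
      Real.exp ((h₁ - h₀) * r) ≤ M * (C * Real.exp (h₀ * a)) / c := by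
    filter_upwards [hN₁, eventually_ge_atTop 0] with r hr hr₀
    have h₂ : ((shortPaths d₁ v₀ r).card : ℝ) ≤ M * (shortPaths d₀ v₀ (r + a)).card := by
      exact_mod_cast hMa r
    have h₃ := mul_le_mul_of_nonneg_left (hN₀ (r + a) (by linarith)) (Nat.cast_nonneg (α := ℝ) M)
    have h₄ := (hr.trans h₂).trans h₃
    rw [mul_add, Real.exp_add] at h₄
    rw [sub_mul, Real.exp_sub, le_div_iff₀ hc, div_mul_eq_mul_div, div_le_iff₀ (Real.exp_pos _)]
    linarith
  have htop : Tendsto (fun r : ℝ => Real.exp ((h₁ - h₀) * r)) atTop atTop :=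
    Real.tendsto_exp_atTop.comp (tendsto_id.const_mul_atTop (sub_pos.2 hlt))
  obtain ⟨r, hr, hr'⟩ := (hbound.and (htop.eventually_gt_atTop _)).exists
  exact absurd hr (not_le.2 hr')

end SerreGraph

/-! ### The unique minimizer and its rigidity -/

theorem corollary4p3 {V E : Type*} [Finite V] [Fintype E] (G : SerreGraph V E) [G.Connected]
    (hdeg : ∀ v, 3 ≤ G.degree v) :
    (∀ (d : G.Lengths) (v₀ : V),
      lowerVolumeGrowth 1 (SerreGraph.MetricTree.root G d v₀) =
        upperVolumeGrowth 1 (SerreGraph.MetricTree.root G d v₀)) ∧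
    ∃ d₀ : G.Lengths, ∀ v₀ : V,
      G.IsEntropyMinimizer v₀ d₀ ∧
      (∀ d : G.Lengths, G.IsEntropyMinimizer v₀ d → d = d₀) ∧
      ∀ d₁ : G.Lengths, G.totalLength d₁ = 1 → d₁ ≠ d₀ →
        ¬ AlmostIsometric (SerreGraph.MetricTree G d₀ v₀) (SerreGraph.MetricTree G d₁ v₀) := by
  have : Nonempty E := SerreGraph.nonempty_edge hdeg
  refine ⟨fun d v₀ => ?_, G.limLengths hdeg, fun v₀ => ⟨⟨G.totalLength_limLengths hdeg, ?_⟩,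
    ?_, ?_⟩⟩
  · obtain ⟨h, hh, x, hx, heig⟩ := SerreGraph.exists_pos_transfer_eq_self hdeg d
    have ht := SerreGraph.tendsto_logVolumeRate hdeg v₀ hh hx heig
    exact ht.liminf_eq.trans ht.limsup_eq.symm
  · intro d hd
    obtain ⟨h, hh, x, hx, heig⟩ := SerreGraph.exists_pos_transfer_eq_self hdeg d
    rw [SerreGraph.volumeEntropy_limLengths, SerreGraph.volumeEntropy_eq hdeg v₀ hh hx heig,
      EReal.coe_le_coe_iff]
    simpa [hd] using SerreGraph.walkEntropy_le hdeg hx heig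
  · intro d hd
    obtain ⟨h, hh, x, hx, heig⟩ := SerreGraph.exists_pos_transfer_eq_self hdeg d
    have h₁ := hd.2 _ (G.totalLength_limLengths hdeg)
    rw [SerreGraph.volumeEntropy_limLengths, SerreGraph.volumeEntropy_eq hdeg v₀ hh hx heig,
      EReal.coe_le_coe_iff] at h₁
    have h₂ := SerreGraph.walkEntropy_le hdeg hx heig
    rw [hd.1, mul_one] at h₂
    obtain rfl : h = G.walkEntropy := le_antisymm h₁ h₂
    exact SerreGraph.eq_limLengths hdeg hx heig hd.1
  · intro d hd hne hiso
    obtain ⟨h, hh, x, hx, heig⟩ := SerreGraph.exists_pos_transfer_eq_self hdeg d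
    -- One inequality suffices: `h ≤ walkEntropy` together with `walkEntropy_le` puts `d` in the
    -- equality case, where its lengths are determined.
    have h₁ := SerreGraph.le_of_almostIsometric hdeg (SerreGraph.walkEntropy_pos hdeg).le hh
      (fun e => Real.sqrt_pos.2 (by linarith [SerreGraph.two_le_branching hdeg (G.tgt e)])) hx
      (G.transfer_limLengths hdeg) heig hiso
    have h₂ := SerreGraph.walkEntropy_le hdeg hx heig
    rw [hd, mul_one] at h₂
    obtain rfl : h = G.walkEntropy := le_antisymm h₁ h₂
    exact hne (SerreGraph.eq_limLengths hdeg hx heig hd)
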